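/- Let $\mathbb D=\{|z|<1\}$ and, for $c\in[-2,2]$, let $F_c(z)=\dfrac{z}{1+cz+z^2}$ and $\omega(z)=z^2$. For each $c\in[-2,2]$ there are unique analytic functions $h_c,g_c$ on $\mathbb D$ with $h_c-g_c=F_c$, $g_c'=\omega h_c'$ and $h_c(0)=g_c(0)=g_c'(0)=h_c'(0)-1=0$. Put $f_c=h_c+\overline{g_c}$ (the horizontal shear of $F_c$ with dilatation $\omega$). (1) For every $c\in[-2,2]$, $f_c$ belongs to $S_H^0$, i.e. it is harmonic and injective on $\mathbb D$ and is of the form $h+\overline g$ with $h,g$ analytic on $\mathbb D$, $h(0)=g(0)=g'(0)=0$, $h'(0)=1$; and $f_c(\mathbb D)$ is a domain convex in the horizontal direction, i.e. it meets every line parallel to the real axis in a connected (possibly empty) set. (2) As $c$ varies from $0$ to $2$ (respectively from $0$ to $-2$), $f_c(\mathbb D)$ deforms continuously from an infinite vertical strip to the plane slit along the positive (respectively negative) real axis. Precisely: $(c,z)\mapsto f_c(z)$ is continuous on $[-2,2]\times\mathbb D$; whenever $c_n\to c_0$ in $[-2,2]$, the domains $f_{c_n}(\mathbb D)$ converge to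 $f_{c_0}(\mathbb D)$ in the sense of Carathéodory kernel convergence with respect to $0$; and $$f_0(\mathbb D)=\{w:|\operatorname{Re}w|<\pi/4\},\qquad f_2(\mathbb D)=\mathbb C\setminus[\tfrac13,\infty),\qquad f_{-2}(\mathbb D)=\mathbb C\setminus(-\infty,-\tfrac13].$$ (3) For every $c\in[-2,2]$ the product $g_c'h_c'$ has an analytic square root on $\mathbb D$ and, for either choice of it, the Weierstrass–Enneper formula $$X_c(z)=\Bigl(\operatorname{Re}\{h_c(z)+g_c(z)\},\ \operatorname{Im}\{h_c(z)-g_c(z)\},\ 2\operatorname{Im}\int_0^z\sqrt{g_c'(\zeta)h_c'(\zeta)}\,d\zeta\Bigr)$$ lifts $f_c$ to a minimal graph: there is a smooth function $\Phi_c$ on the open set $f_c(\mathbb D)$ whose graph has mean curvature zero everywhere and such that $X_c(z)=(u,v,\Phi_c(u,v))$ with $u+iv=f_c(z)$ for all $z\in\mathbb D$. (4) Up to a similarity of $\mathbb R^3$ (an isometry followed by a scaling), $X_{-2}(\mathbb D)$ and $X_2(\mathbb D)$ are parts (subsets) of Enneper's surface $$\bigl\{\bigl(\operatorname{Re}(z-\tfrac{z^3}{3}),\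 \operatorname{Im}(z+\tfrac{z^3}{3}),\ \operatorname{Re}(-z^2)\bigr):z\in\mathbb C\bigr\},$$ and $X_0(\mathbb D)$ is a part of the helicoid $\{(s\cos t,\ s\sin t,\ 2t):s,t\in\mathbb R\}$. -/

import Mathlib

open Set Filter Topology

noncomputable section

namespace HarmonicShear

/-- The open unit disk. -/
abbrev disk : Set ℂ := Metric.ball (0 : ℂ) 1

/-- Euclidean three-space. -/
abbrev E3 : Type := EuclideanSpace ℝ (Fin 3)

/-! ### Harmonic mappings and the shear construction -/

/-- The conformal map `z / (1 + c z + z ^ 2)`. -/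
def slitMap (c : ℝ) (z : ℂ) : ℂ := z / (1 + (c : ℂ) * z + z ^ 2)

/-- The dilatation `z ^ 2`. -/
def sqDilatation (z : ℂ) : ℂ := z ^ 2

/-- The harmonic mapping with analytic part `h` and co-analytic part `g`. -/
def harmonicMap (h g : ℂ → ℂ) (z : ℂ) : ℂ := h z + (starRingEnd ℂ) (g z)

/-- `h` and `g` are the normalized analytic functions on the disk that arise by shearing `F`
horizontally with dilatation `ω`. -/
structure IsNormalizedShear (F ω h g : ℂ → ℂ) : Prop where
  analytic_h : DifferentiableOn ℂ h disk
  analytic_g : DifferentiableOn ℂ g disk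
  sub_eq : ∀ z ∈ disk, h z - g z = F z
  dilatation : ∀ z ∈ disk, deriv g z = ω z * deriv h z
  h_zero : h 0 = 0
  g_zero : g 0 = 0
  deriv_h_zero : deriv h 0 = 1
  deriv_g_zero : deriv g 0 = 0

/-- The class `S_H^0` of normalized univalent harmonic mappings of the disk. -/
structure MemSH0 (f : ℂ → ℂ) : Prop where
  harmonic : InnerProductSpace.HarmonicOnNhd f disk
  univalent : InjOn f disk
  normalized : ∃ h g : ℂ → ℂ, DifferentiableOn ℂ h disk ∧ DifferentiableOn ℂ g disk ∧
    (∀ z ∈ disk, f z = harmonicMap h g z) ∧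
    h 0 = 0 ∧ g 0 = 0 ∧ deriv h 0 = 1 ∧ deriv g 0 = 0

/-- A domain meeting every horizontal line in a connected (possibly empty) set. -/
structure IsCHDDomain (Ω : Set ℂ) : Prop where
  isOpen : IsOpen Ω
  isConnected : IsConnected Ω
  horizontal : ∀ y : ℝ, IsPreconnected (Ω ∩ {w : ℂ | w.im = y})

/-! ### Convergence of domains -/

/-- The Carathéodory kernel, with respect to `w₀`, of a sequence of planar sets. -/
def kernel (Ω : ℕ → Set ℂ) (w₀ : ℂ) : Set ℂ :=
  {w₀} ∪ ⋃₀ {U : Set ℂ | IsOpen U ∧ IsConnected U ∧ w₀ ∈ U ∧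
    ∀ K : Set ℂ, IsCompact K → K ⊆ U → ∀ᶠ n in atTop, K ⊆ Ω n}

/-- Kernel convergence: every subsequence has the same kernel `Ω'`. -/
def KernelConverges (Ω : ℕ → Set ℂ) (w₀ : ℂ) (Ω' : Set ℂ) : Prop :=
  ∀ φ : ℕ → ℕ, StrictMono φ → kernel (fun n => Ω (φ n)) w₀ = Ω'

/-! ### Surfaces in three-space -/

/-- Partial derivative in the direction of the first coordinate of the parameter plane. -/
def pderivU {V : Type*} [NormedAddCommGroup V] [NormedSpace ℝ V] (r : ℂ → V) (w : ℂ) : V :=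
  fderiv ℝ r w 1

/-- Partial derivative in the direction of the second coordinate of the parameter plane. -/
def pderivV {V : Type*} [NormedAddCommGroup V] [NormedSpace ℝ V] (r : ℂ → V) (w : ℂ) : V :=
  fderiv ℝ r w Complex.I

/-- The cross product of Euclidean three-space. -/
def cross (x y : E3) : E3 := WithLp.toLp 2 (crossProduct x.ofLp y.ofLp)

/-- The unit normal of a parametrized surface. -/
def unitNormal (r : ℂ → E3) (w : ℂ) : E3 :=
  ‖cross (pderivU r w) (pderivV r w)‖⁻¹ • cross (pderivU r w) (pderivV r w)

/-- The mean curvature `(e G - 2 f F + g E) / (2 (E G - F ^ 2))` of a parametrized surface, in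
terms of the coefficients `E, F, G` and `e, f, g` of its first and second fundamental forms. -/
def meanCurvature (r : ℂ → E3) (w : ℂ) : ℝ :=
  let E := inner ℝ (pderivU r w) (pderivU r w)
  let F := inner ℝ (pderivU r w) (pderivV r w)
  let G := inner ℝ (pderivV r w) (pderivV r w)
  let e := inner ℝ (pderivU (pderivU r) w) (unitNormal r w)
  let f := inner ℝ (pderivU (pderivV r) w) (unitNormal r w)
  let g := inner ℝ (pderivV (pderivV r) w) (unitNormal r w)
  (e * G - 2 * f * F + g * E) / (2 * (E * G - F ^ 2))

/-- The parametrization `(u, v) ↦ (u, v, Φ (u, v))` of the graph of `Φ`. -/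
def graphParam (Φ : ℂ → ℝ) (w : ℂ) : E3 := !₂[w.re, w.im, Φ w]

/-- `X` is a lift of `f` to a minimal graph: the surface `X(𝔻)` is the graph, over the domain
`f(𝔻)`, of a smooth function whose graph has vanishing mean curvature, and `X z` is the point of
that graph above `f z`. -/
def LiftsToMinimalGraph (f : ℂ → ℂ) (X : ℂ → E3) : Prop :=
  IsOpen (f '' disk) ∧ ∃ Φ : ℂ → ℝ,
    ContDiffOn ℝ (⊤ : ℕ∞) Φ (f '' disk) ∧
    (∀ w ∈ f '' disk, meanCurvature (graphParam Φ) w = 0) ∧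
    ∀ z ∈ disk, X z = graphParam Φ (f z)

/-- `X` is given by the Weierstrass–Enneper formula
`(Re (h + g), Im (h - g), 2 Im ∫₀ᶻ √(g' h'))`; here `p` is either analytic branch of `√(g' h')`,
integrated along the radius from `0` to `z`. -/
def IsWeierstrassEnneperLift (h g : ℂ → ℂ) (X : ℂ → E3) : Prop :=
  ∃ p : ℂ → ℂ, DifferentiableOn ℂ p disk ∧
    (∀ z ∈ disk, p z ^ 2 = deriv g z * deriv h z) ∧
    ∀ z ∈ disk, X z = !₂[(h z + g z).re, (h z - g z).im,
      2 * (∫ t in (0 : ℝ)..1, p ((t : ℂ) * z) * z).im]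

/-- Enneper's surface. -/
def enneperSurface : Set E3 :=
  range fun z : ℂ => (!₂[(z - z ^ 3 / 3).re, (z + z ^ 3 / 3).im, (-z ^ 2).re] : E3)

/-- The helicoid. With `z = r e ^ (i t)` and `s = r - 1 / r` the point below is
`(Re (z - 1 / z), Im (z + 1 / z), 2 Im (log z))`. -/
def helicoid : Set E3 :=
  range fun q : ℝ × ℝ => (!₂[q.1 * Real.cos q.2, q.1 * Real.sin q.2, 2 * q.2] : E3)

/-- Some similarity of three-space (an isometry followed by a scaling) carries `S` into `T`. -/
def IsPartOf (S T : Set E3) : Prop :=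
  ∃ (k : ℝ) (e : E3 ≃ᵢ E3), 0 < k ∧ ∀ x ∈ S, k • e x ∈ T

end HarmonicShear

end

noncomputable section

namespace HarmonicShear

open Complex

/-! ### The shear -/

/-! Differentiating `h - g = F` with `g' = z² h'` gives `(1 - z²) h' = F'`. Since `F' = (1 - z²) /
(1 + cz + z²)²`, the factor `1 - z²` cancels and `h' = 1 / (1 + cz + z²)²`. Hence existence,
uniqueness and `(h + g)' = (1 + z²) / (1 + cz + z²)²`. The shear has the imaginary part of `F` and
the real part of `h + g`.

For `|c| < 2` put `c = 2 cos β` and let `V = r exp(ix)`, `-π < x < 0`, be the Möbius coordinate from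
the disk to the lower half-plane. Then `2 sin²β · Im f = sin x (r - 1/r)/2 =: k`, and on a line `k =
const` the real part is, up to affine normalization, `x + cos β √(sin² x + k²)`. This is strictly
increasing in `x` because `|cos β| < 1`. So each horizontal line meets the image in one explicit
interval, attained injectively (`injOn_harmonicMap_generic`, `image_harmonicMap_generic`). For `c =
±2` a right half-plane coordinate `ζ` plays the same role, with `x = Re ζ` as the monotone parameter
along each line (`image_harmonicMap_slit`).

All images are thus given by explicit inequalities (`shearDomain`), and kernel convergence reduces
to their stability in `β`. The delicate point is `β → 0`, where the bent boundary line folds onto a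
slit with tip `1/3` (`tendsto_rightEnd`). The symmetry `(β, w) ↦ (π - β, -w)` handles the left
boundary.

The root of `g'h'` is `±z h'`. As a function on the disk, the gradient of the height over the image
is `±2 (Im z, Re z) / (1 - |z|²)`, independent of `h'`; the minimal surface equation then becomes a
rational identity in `z` (`minimal_surface_identity`). Closed forms of the lifts in `ζ` and `V`
exhibit Enneper's surface and the helicoid. -/

/-- The denominator of `slitMap c`. -/
def slitDen (c : ℝ) (z : ℂ) : ℂ := 1 + (c : ℂ) * z + z ^ 2

lemma mem_disk_iff {z : ℂ} : z ∈ disk ↔ normSq z < 1 := by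
  rw [mem_ball_zero_iff, normSq_eq_norm_sq, sq_lt_one_iff₀ (norm_nonneg z)]

/-- With `z = x + iy`, the combination `y Re - x Im` of the denominator is `y (1 - |z|²)`, so a zero
in the disk is real; there `1 + cx + x² ≥ (1 - |x|)² > 0`. -/
lemma slitDen_ne_zero {c : ℝ} (hc : c ∈ Icc (-2 : ℝ) 2) {z : ℂ} (hz : z ∈ disk) :
    slitDen c z ≠ 0 := by
  intro h
  rw [mem_disk_iff, normSq_apply] at hz
  have hre := congrArg Complex.re h
  have him := congrArg Complex.im h
  simp [slitDen, sq] at hre him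
  have hy : z.im = 0 := by
    have hm : z.im * (1 - (z.re * z.re + z.im * z.im)) = 0 := by
      linear_combination z.im * hre - z.re * him
    exact (mul_eq_zero.1 hm).resolve_right (by linarith)
  rw [hy] at hre hz
  have hx : |z.re| < 1 := by
    rw [← sq_lt_one_iff_abs_lt_one]; nlinarith
  have hcx : |c * z.re| ≤ 2 * |z.re| := by
    rw [abs_mul]; exact mul_le_mul_of_nonneg_right (abs_le.2 hc) (abs_nonneg _)
  have h1 := neg_abs_le (c * z.re)
  nlinarith [abs_mul_abs_self z.re]

lemma one_sub_sq_ne_zero {z : ℂ} (hz : z ∈ disk) : 1 - z ^ 2 ≠ 0 := by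
  intro h
  have h1 : z ^ 2 = 1 := (sub_eq_zero.1 h).symm
  have h2 : ‖z‖ ^ 2 = 1 := by rw [← norm_pow, h1, norm_one]
  rw [mem_ball_zero_iff] at hz
  nlinarith [norm_nonneg z]

lemma hasDerivAt_slitDen (c : ℝ) (z : ℂ) : HasDerivAt (slitDen c) (c + 2 * z) z := by
  have := (((hasDerivAt_id z).const_mul (c : ℂ)).const_add 1).add ((hasDerivAt_id z).pow 2)
  refine this.congr_deriv ?_
  simp

lemma hasDerivAt_slitMap {c : ℝ} (hc : c ∈ Icc (-2 : ℝ) 2) {z : ℂ} (hz : z ∈ disk) :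
    HasDerivAt (slitMap c) ((1 - z ^ 2) / slitDen c z ^ 2) z := by
  have := (hasDerivAt_id z).div (hasDerivAt_slitDen c z) (slitDen_ne_zero hc hz)
  refine this.congr_deriv ?_
  congr 1
  simp only [slitDen, id]; ring

lemma differentiableOn_inv_slitDen_sq {c : ℝ} (hc : c ∈ Icc (-2 : ℝ) 2) :
    DifferentiableOn ℂ (fun z => 1 / slitDen c z ^ 2) disk := fun z hz =>
  ((differentiableAt_const _).div ((hasDerivAt_slitDen c z).differentiableAt.pow 2)
    (pow_ne_zero 2 (slitDen_ne_zero hc hz))).differentiableWithinAt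

lemma zero_mem_disk : (0 : ℂ) ∈ disk := Metric.mem_ball_self one_pos

lemma isPreconnected_disk : IsPreconnected disk := (convex_ball (0 : ℂ) 1).isPreconnected

lemma eqOn_disk_of_hasDerivAt {f g f' : ℂ → ℂ} (hf : ∀ z ∈ disk, HasDerivAt f (f' z) z)
    (hg : ∀ z ∈ disk, HasDerivAt g (f' z) z) (h0 : f 0 = g 0) : EqOn f g disk :=
  Metric.isOpen_ball.eqOn_of_deriv_eq isPreconnected_disk
    (fun z hz => (hf z hz).differentiableAt.differentiableWithinAt)
    (fun z hz => (hg z hz).differentiableAt.differentiableWithinAt)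
    (fun z hz => by rw [(hf z hz).deriv, (hg z hz).deriv]) zero_mem_disk h0

namespace IsNormalizedShear

variable {c : ℝ} {h g : ℂ → ℂ}

lemma hasDerivAt_h (H : IsNormalizedShear (slitMap c) sqDilatation h g)
    (hc : c ∈ Icc (-2 : ℝ) 2) {z : ℂ} (hz : z ∈ disk) :
    HasDerivAt h (1 / slitDen c z ^ 2) z := by
  have hh := (H.analytic_h.differentiableAt (Metric.isOpen_ball.mem_nhds hz)).hasDerivAt
  have hg := (H.analytic_g.differentiableAt (Metric.isOpen_ball.mem_nhds hz)).hasDerivAt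
  refine hh.congr_deriv ?_
  have hF : HasDerivAt (slitMap c) (deriv h z - deriv g z) z :=
    (hh.sub hg).congr_of_eventuallyEq (by
      filter_upwards [Metric.isOpen_ball.mem_nhds hz] with x hx using (H.sub_eq x hx).symm)
  have he := hF.unique (hasDerivAt_slitMap hc hz)
  rw [H.dilatation z hz, sqDilatation] at he
  have h1 := slitDen_ne_zero hc hz
  have h2 := one_sub_sq_ne_zero hz
  apply mul_left_cancel₀ h2
  rw [mul_one_div, ← he]; ring

lemma hasDerivAt_g (H : IsNormalizedShear (slitMap c) sqDilatation h g)
    (hc : c ∈ Icc (-2 : ℝ) 2) {z : ℂ} (hz : z ∈ disk) :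
    HasDerivAt g (z ^ 2 / slitDen c z ^ 2) z := by
  have hg := (H.analytic_g.differentiableAt (Metric.isOpen_ball.mem_nhds hz)).hasDerivAt
  refine hg.congr_deriv ?_
  rw [H.dilatation z hz, (H.hasDerivAt_h hc hz).deriv, sqDilatation, mul_one_div]

/-- The sum of the two analytic parts is determined by its derivative. -/
lemma add_eq (H : IsNormalizedShear (slitMap c) sqDilatation h g) (hc : c ∈ Icc (-2 : ℝ) 2)
    {k : ℂ → ℂ} (hk : ∀ z ∈ disk, HasDerivAt k ((1 + z ^ 2) / slitDen c z ^ 2) z)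
    (hk0 : k 0 = 0) {z : ℂ} (hz : z ∈ disk) : h z + g z = k z := by
  refine eqOn_disk_of_hasDerivAt (f := fun z => h z + g z)
    (fun z hz => ((H.hasDerivAt_h hc hz).add (H.hasDerivAt_g hc hz)).congr_deriv ?_) hk ?_ hz
  · rw [← add_div]
  · simp [hk0, H.h_zero, H.g_zero]

lemma harmonicMap_re (z : ℂ) : (harmonicMap h g z).re = (h z + g z).re := by
  simp [harmonicMap]

lemma harmonicMap_im' (z : ℂ) : (harmonicMap h g z).im = (h z - g z).im := by
  simp [harmonicMap, sub_eq_add_neg]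

lemma harmonicMap_im (H : IsNormalizedShear (slitMap c) sqDilatation h g) {z : ℂ}
    (hz : z ∈ disk) : (harmonicMap h g z).im = (slitMap c z).im := by
  rw [← H.sub_eq z hz, harmonicMap_im']

lemma harmonicOnNhd (H : IsNormalizedShear (slitMap c) sqDilatation h g) :
    InnerProductSpace.HarmonicOnNhd (harmonicMap h g) disk := fun _ hz =>
  (H.analytic_h.analyticAt (Metric.isOpen_ball.mem_nhds hz)).harmonicAt.add
    ((H.analytic_g.analyticAt (Metric.isOpen_ball.mem_nhds hz)).harmonicAt.comp_CLM
      (conjCLE : ℂ →L[ℝ] ℂ))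

lemma continuousOn (H : IsNormalizedShear (slitMap c) sqDilatation h g) :
    ContinuousOn (harmonicMap h g) disk :=
  H.analytic_h.continuousOn.add (continuous_conj.comp_continuousOn H.analytic_g.continuousOn)

lemma memSH0 (H : IsNormalizedShear (slitMap c) sqDilatation h g)
    (hinj : InjOn (harmonicMap h g) disk) : MemSH0 (harmonicMap h g) where
  harmonic := H.harmonicOnNhd
  univalent := hinj
  normalized := ⟨h, g, H.analytic_h, H.analytic_g, fun _ _ => rfl, H.h_zero, H.g_zero,
    H.deriv_h_zero, H.deriv_g_zero⟩

end IsNormalizedShear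

/-- Integration of a derivative along a radius of the disk. -/
lemma integral_radius_eq {p P : ℂ → ℂ} (hp : ContinuousOn p disk)
    (hP : ∀ z ∈ disk, HasDerivAt P (p z) z) {z : ℂ} (hz : z ∈ disk) :
    ∫ t in (0 : ℝ)..1, p ((t : ℂ) * z) * z = P z - P 0 := by
  have hmem : ∀ t ∈ uIcc (0 : ℝ) 1, (t : ℂ) * z ∈ disk := by
    intro t ht
    rw [uIcc_of_le zero_le_one] at ht
    rw [mem_ball_zero_iff] at hz ⊢
    rw [norm_mul, norm_real, Real.norm_eq_abs, abs_of_nonneg ht.1]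
    nlinarith [norm_nonneg z, ht.2]
  rw [intervalIntegral.integral_eq_sub_of_hasDerivAt (f := fun t : ℝ => P ((t : ℂ) * z))]
  · simp
  · intro t ht
    have h1 : HasDerivAt (fun t : ℝ => (t : ℂ) * z) z t := by
      simpa using (ofRealCLM.hasDerivAt (x := t)).mul_const z
    exact (hP _ (hmem t ht)).comp t h1
  · refine ContinuousOn.intervalIntegrable ?_
    exact (hp.comp (by fun_prop) hmem).mul continuousOn_const

lemma exists_isNormalizedShear {c : ℝ} (hc : c ∈ Icc (-2 : ℝ) 2) :
    ∃ h g : ℂ → ℂ, IsNormalizedShear (slitMap c) sqDilatation h g := by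
  obtain ⟨h, h0, hh⟩ := (differentiableOn_inv_slitDen_sq hc).isExactOn_ball.with_val_at 0 0
  have hg : ∀ z ∈ disk, HasDerivAt (fun z => h z - slitMap c z) (z ^ 2 / slitDen c z ^ 2) z :=
    fun z hz => ((hh z hz).sub (hasDerivAt_slitMap hc hz)).congr_deriv (by
      rw [← sub_div]; ring)
  refine ⟨h, fun z => h z - slitMap c z,
    fun z hz => (hh z hz).differentiableAt.differentiableWithinAt,
    fun z hz => (hg z hz).differentiableAt.differentiableWithinAt,
    fun z _ => by ring, fun z hz => ?_, h0, ?_, ?_, ?_⟩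
  · rw [(hg z hz).deriv, (hh z hz).deriv, sqDilatation, mul_one_div]
  · simp [h0, slitMap]
  · rw [(hh 0 zero_mem_disk).deriv]; simp [slitDen]
  · rw [(hg 0 zero_mem_disk).deriv]; simp

lemma IsNormalizedShear.eqOn {c : ℝ} (hc : c ∈ Icc (-2 : ℝ) 2) {h g h' g' : ℂ → ℂ}
    (H : IsNormalizedShear (slitMap c) sqDilatation h g)
    (H' : IsNormalizedShear (slitMap c) sqDilatation h' g') :
    EqOn h' h disk ∧ EqOn g' g disk :=
  ⟨eqOn_disk_of_hasDerivAt (fun _ hz => H'.hasDerivAt_h hc hz)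
    (fun _ hz => H.hasDerivAt_h hc hz) (H'.h_zero.trans H.h_zero.symm),
  eqOn_disk_of_hasDerivAt (fun _ hz => H'.hasDerivAt_g hc hz)
    (fun _ hz => H.hasDerivAt_g hc hz) (H'.g_zero.trans H.g_zero.symm)⟩

/-- The sheared maps depend continuously on the parameter. -/
lemma continuousOn_harmonicMap {h g : ℝ → ℂ → ℂ}
    (H : ∀ c ∈ Icc (-2 : ℝ) 2, IsNormalizedShear (slitMap c) sqDilatation (h c) (g c)) :
    ContinuousOn (fun q : ℝ × ℂ => harmonicMap (h q.1) (g q.1) q.2)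
      (Icc (-2 : ℝ) 2 ×ˢ disk) := by
  have hden : Continuous fun q : ℝ × ℂ => slitDen q.1 q.2 := by
    unfold slitDen; fun_prop
  have hF : ContinuousOn (fun q : ℝ × ℂ => slitMap q.1 q.2) (Icc (-2 : ℝ) 2 ×ˢ disk) :=
    continuous_snd.continuousOn.div hden.continuousOn fun q hq => slitDen_ne_zero hq.1 hq.2
  have hh : ContinuousOn (fun q : ℝ × ℂ => h q.1 q.2) (Icc (-2 : ℝ) 2 ×ˢ disk) := by
    rw [continuousOn_iff_continuous_domRestrict]
    -- `h` is a radial integral depending on a parameter. Clamping `t` to `[0, 1]` keeps `t z` in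
    -- the disk, so the integrand is continuous for all real `t`; the integral over `[0, 1]` is
    -- unaffected.
    have hclamp : ∀ (q : ↥(Icc (-2 : ℝ) 2 ×ˢ disk)) (t : ℝ),
        ((projIcc (0 : ℝ) 1 zero_le_one t : ℝ) : ℂ) * q.1.2 ∈ disk := by
      intro q t
      obtain ⟨h0, h1⟩ := (projIcc (0 : ℝ) 1 zero_le_one t).2
      have hq := q.2.2
      rw [mem_ball_zero_iff] at hq ⊢
      rw [norm_mul, norm_real, Real.norm_eq_abs, abs_of_nonneg h0]
      nlinarith [norm_nonneg q.1.2]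
    have hcont : Continuous (Function.uncurry fun (q : ↥(Icc (-2 : ℝ) 2 ×ˢ disk)) (t : ℝ) =>
        1 / slitDen q.1.1 (((projIcc (0 : ℝ) 1 zero_le_one t : ℝ) : ℂ) * q.1.2) ^ 2 *
          q.1.2) := by
      refine Continuous.mul (continuous_const.div (Continuous.pow ?_ 2) ?_) (by fun_prop)
      · refine hden.comp (Continuous.prodMk (by fun_prop) (Continuous.mul ?_ (by fun_prop)))
        exact continuous_ofReal.comp (continuous_subtype_val.comp
          (continuous_projIcc.comp continuous_snd))
      · rintro ⟨q, t⟩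
        exact pow_ne_zero 2 (slitDen_ne_zero q.2.1 (hclamp q t))
    refine (intervalIntegral.continuous_parametric_intervalIntegral_of_continuous'
      (μ := MeasureTheory.volume) hcont 0 1).congr ?_
    intro q
    have hi := integral_radius_eq (differentiableOn_inv_slitDen_sq q.2.1).continuousOn
      (fun z hz => (H _ q.2.1).hasDerivAt_h q.2.1 hz) q.2.2
    rw [(H _ q.2.1).h_zero, sub_zero] at hi
    simp only [domRestrict_apply]
    rw [← hi]
    refine intervalIntegral.integral_congr fun t ht => ?_
    rw [uIcc_of_le zero_le_one] at ht
    simp only [projIcc_of_mem zero_le_one ht]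
  refine (hh.add (continuous_conj.comp_continuousOn (hh.sub hF))).congr ?_
  intro q hq
  simp [harmonicMap, ← (H _ hq.1).sub_eq _ hq.2]

/-! ### The image domains -/

/-- The points to the left of the right boundary of the image of the shear of
`slitMap (2 * cos β)`. -/
def LeftOfBoundary (β : ℝ) (w : ℂ) : Prop :=
  if β = 0 then w.im = 0 → w.re < 1 / 3
  else 2 * Real.sin β ^ 3 * w.re <
    β - Real.sin β * Real.cos β + 2 * Real.cos β * Real.sin β ^ 2 * |w.im|

/-- The image of the disk under the shear of `slitMap (2 * cos β)`. -/
def shearDomain (β : ℝ) : Set ℂ :=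
  {w | LeftOfBoundary β w ∧ LeftOfBoundary (Real.pi - β) (-w)}

/-- On a horizontal line the condition is an upper bound on the real part; together with its mirror
image this gives horizontal convexity. -/
lemma LeftOfBoundary.mono {β : ℝ} (hβ : β ∈ Icc 0 Real.pi) {w w' : ℂ}
    (h : LeftOfBoundary β w) (him : w'.im = w.im) (hre : w'.re ≤ w.re) :
    LeftOfBoundary β w' := by
  unfold LeftOfBoundary at h ⊢
  have hs : 0 ≤ Real.sin β := Real.sin_nonneg_of_mem_Icc hβ
  split_ifs at h ⊢ with h0
  · intro h1; exact hre.trans_lt (h (him ▸ h1))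
  · rw [him]
    exact (mul_le_mul_of_nonneg_left hre (by positivity)).trans_lt h

lemma isPreconnected_horizontal {Ω : Set ℂ}
    (hΩ : ∀ w₁ ∈ Ω, ∀ w₂ ∈ Ω, ∀ w : ℂ, w.im = w₁.im → w.im = w₂.im → w₁.re ≤ w.re →
      w.re ≤ w₂.re → w ∈ Ω) (y : ℝ) : IsPreconnected (Ω ∩ {w : ℂ | w.im = y}) := by
  have h1 : IsPreconnected {u : ℝ | (⟨u, y⟩ : ℂ) ∈ Ω} := by
    apply OrdConnected.isPreconnected
    refine ⟨fun a ha b hb t ht => ?_⟩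
    exact hΩ _ ha _ hb ⟨t, y⟩ rfl rfl ht.1 ht.2
  have h2 : Continuous fun u : ℝ => (⟨u, y⟩ : ℂ) := by
    have : (fun u : ℝ => (⟨u, y⟩ : ℂ)) = fun u : ℝ => (u : ℂ) + y * I := by
      ext u; apply Complex.ext <;> simp
    rw [this]; fun_prop
  have h3 := h1.image _ h2.continuousOn
  convert h3 using 1
  ext w
  constructor
  · rintro ⟨hw, rfl⟩
    exact ⟨w.re, hw, rfl⟩
  · rintro ⟨u, hu, rfl⟩
    exact ⟨hu, rfl⟩

lemma pi_sub_mem_Icc {β : ℝ} (hβ : β ∈ Icc 0 Real.pi) : Real.pi - β ∈ Icc 0 Real.pi :=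
  ⟨by linarith [hβ.2], by linarith [hβ.1]⟩

lemma isPreconnected_shearDomain_horizontal {β : ℝ} (hβ : β ∈ Icc 0 Real.pi) (y : ℝ) :
    IsPreconnected (shearDomain β ∩ {w : ℂ | w.im = y}) :=
  isPreconnected_horizontal (fun w₁ (h₁ : w₁ ∈ shearDomain β) _ h₂ _ e₁ e₂ l₁ l₂ =>
    ⟨h₂.1.mono hβ e₂ l₂, h₁.2.mono (pi_sub_mem_Icc hβ) (by simpa using e₁) (by simpa using l₁)⟩) y

/-! ### Bent strips -/

section BentStrip

variable {C k : ℝ}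

/-- The real part of the shear along a horizontal line, up to normalization. -/
def bentCoord (C k x : ℝ) : ℝ := x + C * √(Real.sin x ^ 2 + k ^ 2)

/-- Reverse triangle inequality for `a + ik` and `b + ik`. -/
lemma abs_sqrt_sq_add_sub_le (a b k : ℝ) : |√(a ^ 2 + k ^ 2) - √(b ^ 2 + k ^ 2)| ≤ |a - b| := by
  have h := abs_norm_sub_norm_le (⟨a, k⟩ : ℂ) ⟨b, k⟩
  simpa [Complex.norm_def, normSq_apply, ← sq, Real.sqrt_sq_eq_abs] using h

/-- The square root is 1-Lipschitz in `sin x`, hence in `x`, so a multiple of it with `|C| < 1`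
cannot undo the growth of `x`. -/
lemma bentCoord_strictMono (hC : |C| < 1) : StrictMono (bentCoord C k) := by
  intro x y hxy
  have h1 := abs_sqrt_sq_add_sub_le (Real.sin x) (Real.sin y) k
  have h2 : |Real.sin x - Real.sin y| ≤ |x - y| := by
    simpa [Real.dist_eq] using Real.lipschitzWith_sin.dist_le_mul x y
  have h3 : |C * (√(Real.sin x ^ 2 + k ^ 2) - √(Real.sin y ^ 2 + k ^ 2))| < |x - y| := by
    rw [abs_mul]
    have h4 : 0 < |x - y| := abs_pos.2 (sub_ne_zero.2 hxy.ne)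
    calc _ ≤ |C| * |x - y| := mul_le_mul_of_nonneg_left (h1.trans h2) (abs_nonneg _)
      _ < 1 * |x - y| := mul_lt_mul_of_pos_right hC h4
      _ = _ := one_mul _
  rw [abs_of_neg (sub_neg.2 hxy)] at h3
  have h5 := (abs_lt.1 h3).2
  unfold bentCoord
  linarith

lemma continuous_bentCoord : Continuous (bentCoord C k) := by
  unfold bentCoord; fun_prop

/-- Since `sin` vanishes at `-π` and `0`, the root is `|k|` at both ends: the two boundary curves
are translates of one bent line. -/
lemma exists_bentCoord_eq_iff (hC : |C| < 1) {t : ℝ} :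
    (∃ x ∈ Ioo (-Real.pi) 0, bentCoord C k x = t) ↔
      t ∈ Ioo (-Real.pi + C * |k|) (C * |k|) := by
  have h0 : bentCoord C k 0 = C * |k| := by simp [bentCoord, Real.sqrt_sq_eq_abs]
  have hp : bentCoord C k (-Real.pi) = -Real.pi + C * |k| := by
    simp [bentCoord, Real.sqrt_sq_eq_abs]
  constructor
  · rintro ⟨x, hx, rfl⟩
    rw [← hp, ← h0]
    exact ⟨bentCoord_strictMono hC hx.1, bentCoord_strictMono hC hx.2⟩
  · intro ht
    rw [← hp, ← h0] at ht
    exact intermediate_value_Ioo (by linarith [Real.pi_pos]) continuous_bentCoord.continuousOn ht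

end BentStrip

/-! ### The half-plane coordinate -/

/-- The unimodular number `exp (-iβ)`. -/
def unimod (β : ℝ) : ℂ := exp (-(β * I))

lemma unimod_eq (β : ℝ) : unimod β = Real.cos β - Real.sin β * I := by
  rw [unimod, ← neg_mul, exp_mul_I]; simp [sub_eq_add_neg]

lemma unimod_re (β : ℝ) : (unimod β).re = Real.cos β := by
  rw [unimod_eq]; simp [-ofReal_cos, -ofReal_sin]

lemma unimod_im (β : ℝ) : (unimod β).im = -Real.sin β := by
  rw [unimod_eq]; simp [-ofReal_cos, -ofReal_sin]

lemma norm_unimod (β : ℝ) : ‖unimod β‖ = 1 := by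
  simp [unimod, Complex.norm_exp]

lemma unimod_ne_zero (β : ℝ) : unimod β ≠ 0 := exp_ne_zero _

lemma unimod_sq_add_one (β : ℝ) : unimod β ^ 2 + 1 = 2 * Real.cos β * unimod β := by
  have h : ((Real.sin β : ℝ) : ℂ) ^ 2 + ((Real.cos β : ℝ) : ℂ) ^ 2 = 1 := by
    exact_mod_cast Real.sin_sq_add_cos_sq β
  rw [unimod_eq]
  linear_combination ((Real.sin β : ℝ) : ℂ) ^ 2 * I_sq - h

lemma one_sub_unimod_sq (β : ℝ) : 1 - unimod β ^ 2 = 2 * I * Real.sin β * unimod β := by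
  have h : ((Real.sin β : ℝ) : ℂ) ^ 2 + ((Real.cos β : ℝ) : ℂ) ^ 2 = 1 := by
    exact_mod_cast Real.sin_sq_add_cos_sq β
  rw [unimod_eq]
  linear_combination ((Real.sin β : ℝ) : ℂ) ^ 2 * I_sq - h

lemma one_add_unimod_mul_ne_zero (β : ℝ) {z : ℂ} (hz : z ∈ disk) : 1 + unimod β * z ≠ 0 := by
  intro h
  have h1 : ‖unimod β * z‖ = 1 := by rw [eq_neg_of_add_eq_zero_right h, norm_neg, norm_one]
  rw [norm_mul, norm_unimod, one_mul] at h1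
  rw [mem_ball_zero_iff] at hz
  exact hz.ne h1

lemma unimod_add_ne_zero (β : ℝ) {z : ℂ} (hz : z ∈ disk) : unimod β + z ≠ 0 := by
  intro h
  have h1 : ‖z‖ = 1 := by rw [eq_neg_of_add_eq_zero_right h, norm_neg, norm_unimod]
  rw [mem_ball_zero_iff] at hz
  exact hz.ne h1

/-- The Möbius transformation of the disk onto the lower half-plane. -/
def halfPlaneCoord (β : ℝ) (z : ℂ) : ℂ := (unimod β + z) / (1 + unimod β * z)

lemma slitDen_two_mul_cos (β : ℝ) (z : ℂ) :
    slitDen (2 * Real.cos β) z = (1 + unimod β * z) * (unimod β + z) / unimod β := by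
  rw [eq_div_iff (unimod_ne_zero β)]
  simp only [slitDen, ofReal_mul, ofReal_ofNat]
  linear_combination (-z) * unimod_sq_add_one β

lemma halfPlaneCoord_im_neg {β : ℝ} (hβ : 0 < Real.sin β) {z : ℂ} (hz : z ∈ disk) :
    (halfPlaneCoord β z).im < 0 := by
  have h0 := normSq_pos.2 (one_add_unimod_mul_ne_zero β hz)
  rw [mem_disk_iff, normSq_apply] at hz
  rw [halfPlaneCoord, div_im, ← sub_div]
  refine div_neg_of_neg_of_pos ?_ h0
  have h1 := Real.sin_sq_add_cos_sq β
  simp only [add_re, add_im, mul_re, mul_im, one_re, one_im, unimod_re, unimod_im]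
  have h2 : Real.sin β * (z.re * z.re + z.im * z.im - 1) < 0 :=
    mul_neg_of_pos_of_neg hβ (by linarith)
  refine lt_of_eq_of_lt ?_ h2
  linear_combination (-z.im) * h1

lemma halfPlaneCoord_ne_zero (β : ℝ) {z : ℂ} (hz : z ∈ disk) : halfPlaneCoord β z ≠ 0 :=
  div_ne_zero (unimod_add_ne_zero β hz) (one_add_unimod_mul_ne_zero β hz)

lemma one_sub_unimod_sq_ne_zero {β : ℝ} (hβ : 0 < Real.sin β) : 1 - unimod β ^ 2 ≠ 0 := by
  rw [one_sub_unimod_sq]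
  have : ((Real.sin β : ℝ) : ℂ) ≠ 0 := ofReal_ne_zero.2 hβ.ne'
  exact mul_ne_zero (mul_ne_zero (mul_ne_zero two_ne_zero I_ne_zero) this) (unimod_ne_zero β)

lemma halfPlaneCoord_injOn {β : ℝ} (hβ : 0 < Real.sin β) : InjOn (halfPlaneCoord β) disk := by
  intro z hz w hw h
  rw [halfPlaneCoord, halfPlaneCoord, div_eq_div_iff (one_add_unimod_mul_ne_zero β hz)
    (one_add_unimod_mul_ne_zero β hw)] at h
  have h1 : (1 - unimod β ^ 2) * (z - w) = 0 := by linear_combination h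
  exact sub_eq_zero.1 ((mul_eq_zero.1 h1).resolve_left (one_sub_unimod_sq_ne_zero hβ))

lemma exists_halfPlaneCoord_eq {β : ℝ} (hβ : 0 < Real.sin β) {V : ℂ} (hV : V.im < 0) :
    ∃ z ∈ disk, halfPlaneCoord β z = V := by
  -- The inverse Möbius map is `(V - e) / (1 - eV)` with `e = unimod β`, and `|1 - eV|² - |V - e|² =
  -- -4 sin β · Im V`.
  have hn : normSq (V - unimod β) < normSq (1 - unimod β * V) := by
    have h1 := Real.sin_sq_add_cos_sq β
    simp only [normSq_apply, sub_re, sub_im, mul_re, mul_im, one_re, one_im, unimod_re, unimod_im]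
    have h2 : 0 < -4 * Real.sin β * V.im := by nlinarith
    rw [← sub_pos]
    refine lt_of_lt_of_eq h2 ?_
    linear_combination (V.re ^ 2 + V.im ^ 2 - 1) * (-h1)
  have hne : 1 - unimod β * V ≠ 0 := normSq_pos.1 ((normSq_nonneg _).trans_lt hn)
  have hz : (V - unimod β) / (1 - unimod β * V) ∈ disk := by
    rw [mem_disk_iff, map_div₀, div_lt_one (normSq_pos.2 hne)]
    exact hn
  refine ⟨_, hz, ?_⟩
  have h3 := one_add_unimod_mul_ne_zero β hz
  rw [halfPlaneCoord, div_eq_iff h3]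
  field_simp
  ring

lemma slitMap_eq_halfPlaneCoord {β : ℝ} (hβ : 0 < Real.sin β) {z : ℂ} (hz : z ∈ disk) :
    slitMap (2 * Real.cos β) z =
      ((halfPlaneCoord β z + (halfPlaneCoord β z)⁻¹) / 2 - Real.cos β) /
        (2 * Real.sin β ^ 2 : ℝ) := by
  have h1 := unimod_sq_add_one β
  have h2 := one_sub_unimod_sq β
  have ha := one_add_unimod_mul_ne_zero β hz
  have hb := unimod_add_ne_zero β hz
  have he := unimod_ne_zero β
  have hS : ((Real.sin β : ℝ) : ℂ) ≠ 0 := ofReal_ne_zero.2 hβ.ne'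
  change z / slitDen (2 * Real.cos β) z = _
  rw [slitDen_two_mul_cos, halfPlaneCoord]
  push_cast [-ofReal_cos, -ofReal_sin]
  generalize unimod β = e at *
  generalize ((Real.sin β : ℝ) : ℂ) = S at *
  generalize ((Real.cos β : ℝ) : ℂ) = C at *
  -- With `a = 1 + ez` and `b = e + z`, so that `V = b / a`, clearing denominators reduces the claim
  -- to `4 S² z e = a² + b² - 2Cab`.
  have key : 4 * S ^ 2 * z * e =
      (e + z) ^ 2 + (1 + e * z) ^ 2 - 2 * C * (e + z) * (1 + e * z) := by
    apply mul_left_cancel₀ he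
    have h3 : 4 * S ^ 2 * e ^ 2 = -(1 - e ^ 2) ^ 2 := by
      rw [h2]; linear_combination 4 * S ^ 2 * e ^ 2 * I_sq
    linear_combination z * h3 - (e + z) * (1 + e * z) * h1
  generalize 1 + e * z = a at *
  generalize e + z = b at *
  field_simp
  linear_combination key

lemma hasDerivAt_halfPlaneCoord (β : ℝ) {z : ℂ} (hz : z ∈ disk) :
    HasDerivAt (halfPlaneCoord β) ((1 - unimod β ^ 2) / (1 + unimod β * z) ^ 2) z := by
  have := ((hasDerivAt_id z).const_add (unimod β)).div
    (((hasDerivAt_id z).const_mul (unimod β)).const_add 1) (one_add_unimod_mul_ne_zero β hz)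
  refine this.congr_deriv ?_
  simp only [id]
  congr 1
  ring

/-- The sum of the analytic parts of the shear in terms of the half-plane coordinate. -/
def shearSum (β : ℝ) (V : ℂ) : ℂ :=
  (-I * log V + β - Real.cos β * ((V - V⁻¹) / (2 * I) + Real.sin β)) / (2 * Real.sin β ^ 3 : ℝ)

lemma hasDerivAt_shearSum {β : ℝ} (hβ : 0 < Real.sin β) {z : ℂ} (hz : z ∈ disk) :
    HasDerivAt (fun z => shearSum β (halfPlaneCoord β z))
      ((1 + z ^ 2) / slitDen (2 * Real.cos β) z ^ 2) z := by
  have hV := hasDerivAt_halfPlaneCoord β hz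
  have hsl : halfPlaneCoord β z ∈ slitPlane := Or.inr (halfPlaneCoord_im_neg hβ hz).ne
  have hV0 := halfPlaneCoord_ne_zero β hz
  have := (((((hV.clog hsl).const_mul (-I)).add_const (β : ℂ)).sub
    ((((hV.sub (hV.inv hV0)).div_const (2 * I)).add_const
      ((Real.sin β : ℝ) : ℂ)).const_mul ((Real.cos β : ℝ) : ℂ))).div_const
      ((2 * Real.sin β ^ 3 : ℝ) : ℂ))
  refine this.congr_deriv ?_
  have h1 := unimod_sq_add_one β
  have h2 := one_sub_unimod_sq β
  have ha := one_add_unimod_mul_ne_zero β hz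
  have hb := unimod_add_ne_zero β hz
  have he := unimod_ne_zero β
  have hS : ((Real.sin β : ℝ) : ℂ) ≠ 0 := ofReal_ne_zero.2 hβ.ne'
  rw [slitDen_two_mul_cos, halfPlaneCoord]
  push_cast [-ofReal_cos, -ofReal_sin]
  generalize unimod β = e at *
  generalize ((Real.sin β : ℝ) : ℂ) = S at *
  generalize ((Real.cos β : ℝ) : ℂ) = C at *
  have h3 : 4 * S ^ 2 * e ^ 2 = -(1 - e ^ 2) ^ 2 := by
    rw [h2]; linear_combination 4 * S ^ 2 * e ^ 2 * I_sq
  have key : e * ((1 + e * z) * (e + z)) - C * e * ((1 + e * z) ^ 2 + (e + z) ^ 2) / 2 =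
      S ^ 2 * e ^ 2 * (1 + z ^ 2) := by
    linear_combination (-(1 + z ^ 2) / 4) * h3 + ((1 + e * z) ^ 2 + (e + z) ^ 2) / 4 * h1
  rw [h2]
  have hI := I_ne_zero
  clear hV hsl hV0 this
  generalize 1 + e * z = a at *
  generalize e + z = b at *
  field_simp
  simp only [I_sq]
  apply mul_left_cancel₀ he
  linear_combination 2 * key

lemma inv_im_eq (V : ℂ) : (V⁻¹).im = -(Real.sin V.arg / ‖V‖) := by
  rw [inv_im, Complex.sin_arg, normSq_eq_norm_sq]
  rw [div_div, sq, neg_div]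

lemma inv_re_eq {V : ℂ} (hV : V ≠ 0) : (V⁻¹).re = Real.cos V.arg / ‖V‖ := by
  rw [inv_re, Complex.cos_arg hV, normSq_eq_norm_sq, div_div, sq]

lemma two_mul_cos_mem_Icc (β : ℝ) : 2 * Real.cos β ∈ Icc (-2 : ℝ) 2 :=
  ⟨by linarith [Real.neg_one_le_cos β], by linarith [Real.cos_le_one β]⟩

/-! ### Univalence and image for `|c| < 2`, in polar coordinates of `V`. -/

section Generic

variable {β : ℝ} {h g : ℂ → ℂ}

/-- The additive constants in `shearSum` make it vanish at `z = 0`, where `V = exp(-iβ)`, `log V =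
-iβ` and `(V - V⁻¹) / (2i) = -sin β`. -/
lemma shear_add_eq_shearSum (hβ : β ∈ Ioo 0 Real.pi)
    (H : IsNormalizedShear (slitMap (2 * Real.cos β)) sqDilatation h g) {z : ℂ}
    (hz : z ∈ disk) : h z + g z = shearSum β (halfPlaneCoord β z) := by
  refine H.add_eq (two_mul_cos_mem_Icc β) (k := fun z => shearSum β (halfPlaneCoord β z))
    (fun z hz => hasDerivAt_shearSum (Real.sin_pos_of_mem_Ioo hβ) hz) ?_ hz
  have h1 : halfPlaneCoord β 0 = unimod β := by simp [halfPlaneCoord]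
  have h2 : log (unimod β) = -(β * I) := by
    rw [unimod, log_exp] <;> simp <;> linarith [hβ.1, hβ.2]
  have h3 : (unimod β)⁻¹ = Real.cos β + Real.sin β * I := by
    rw [unimod, ← exp_neg, neg_neg, exp_mul_I]; simp
  have h4 : (unimod β - (unimod β)⁻¹) / (2 * I) = -Real.sin β := by
    rw [h3, unimod_eq]
    have := I_ne_zero
    field_simp
    ring
  have h5 : -I * -(β * I) + β = 0 := by linear_combination (β : ℂ) * I_sq
  simp only [h1, shearSum, h2, h4, h5]
  simp

lemma harmonicMap_im_halfPlane (hβ : β ∈ Ioo 0 Real.pi)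
    (H : IsNormalizedShear (slitMap (2 * Real.cos β)) sqDilatation h g) {z V : ℂ}
    (hz : z ∈ disk) (hV : halfPlaneCoord β z = V) :
    2 * Real.sin β ^ 2 * (harmonicMap h g z).im =
      Real.sin V.arg * ((‖V‖ - ‖V‖⁻¹) / 2) := by
  have hs := Real.sin_pos_of_mem_Ioo hβ
  rw [H.harmonicMap_im hz, slitMap_eq_halfPlaneCoord hs hz, hV, div_ofReal_im]
  rw [mul_div_cancel₀ _ (by positivity)]
  have h1 : V.im = ‖V‖ * Real.sin V.arg := (norm_mul_sin_arg V).symm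
  rw [sub_im, ofReal_im, sub_zero, ← ofReal_ofNat, div_ofReal_im, add_im, inv_im_eq, h1]
  ring

lemma harmonicMap_re_halfPlane (hβ : β ∈ Ioo 0 Real.pi)
    (H : IsNormalizedShear (slitMap (2 * Real.cos β)) sqDilatation h g) {z V : ℂ}
    (hz : z ∈ disk) (hV : halfPlaneCoord β z = V) :
    2 * Real.sin β ^ 3 * (harmonicMap h g z).re = V.arg + β -
      Real.cos β * (Real.sin V.arg * ((‖V‖ + ‖V‖⁻¹) / 2) + Real.sin β) := by
  have hs := Real.sin_pos_of_mem_Ioo hβ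
  rw [IsNormalizedShear.harmonicMap_re, shear_add_eq_shearSum hβ H hz, hV, shearSum,
    div_ofReal_re, mul_div_cancel₀ _ (by positivity)]
  have h1 : V.im = ‖V‖ * Real.sin V.arg := (norm_mul_sin_arg V).symm
  have h2 : (V - V⁻¹) / (2 * I) = -((V - V⁻¹) * I / (2 : ℝ)) := by
    have := I_ne_zero
    push_cast
    generalize V - V⁻¹ = D
    rw [div_eq_iff (by simp)]
    linear_combination D * I_sq
  rw [h2]
  simp only [sub_re, add_re, mul_re, neg_re, neg_im, I_re, I_im, log_im, ofReal_re, ofReal_im,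
    div_ofReal_re, sub_im, inv_im_eq, h1]
  ring

lemma norm_pos_of_im_neg {V : ℂ} (hV : V.im < 0) : 0 < ‖V‖ :=
  norm_pos_iff.2 fun h => by simp [h] at hV

lemma arg_mem_Ioo {V : ℂ} (hV : V.im < 0) : V.arg ∈ Ioo (-Real.pi) 0 :=
  ⟨neg_pi_lt_arg V, arg_neg_iff.2 hV⟩

/-- The real part of the shear in terms of its imaginary part. -/
lemma harmonicMap_re_bentCoord (hβ : β ∈ Ioo 0 Real.pi)
    (H : IsNormalizedShear (slitMap (2 * Real.cos β)) sqDilatation h g) {z V : ℂ}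
    (hz : z ∈ disk) (hV : halfPlaneCoord β z = V) :
    2 * Real.sin β ^ 3 * (harmonicMap h g z).re - β + Real.sin β * Real.cos β =
      bentCoord (Real.cos β) (2 * Real.sin β ^ 2 * (harmonicMap h g z).im) V.arg := by
  have hVim : V.im < 0 := hV ▸ halfPlaneCoord_im_neg (Real.sin_pos_of_mem_Ioo hβ) hz
  have hr := norm_pos_of_im_neg hVim
  have hx := arg_mem_Ioo hVim
  have hsin : Real.sin V.arg < 0 := Real.sin_neg_of_neg_of_neg_pi_lt hx.2 hx.1
  rw [harmonicMap_re_halfPlane hβ H hz hV, harmonicMap_im_halfPlane hβ H hz hV, bentCoord]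
  -- `((r + 1/r)/2)² = 1 + ((r - 1/r)/2)²` eliminates `r` in favour of the imaginary part; the minus
  -- sign selects the nonnegative root, as `sin x < 0`.
  have h1 : Real.sin V.arg ^ 2 + (Real.sin V.arg * ((‖V‖ - ‖V‖⁻¹) / 2)) ^ 2 =
      (-(Real.sin V.arg * ((‖V‖ + ‖V‖⁻¹) / 2))) ^ 2 := by
    field_simp
    ring
  have h2 : 0 ≤ -(Real.sin V.arg * ((‖V‖ + ‖V‖⁻¹) / 2)) := by
    rw [← neg_mul]
    exact mul_nonneg (by linarith) (by positivity)
  rw [h1, Real.sqrt_sq h2]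
  ring

lemma abs_cos_lt_one (hβ : β ∈ Ioo 0 Real.pi) : |Real.cos β| < 1 := by
  have := Real.sin_sq_add_cos_sq β
  have hs := Real.sin_pos_of_mem_Ioo hβ
  rw [← sq_lt_one_iff_abs_lt_one]
  nlinarith

lemma strictMonoOn_sub_inv : StrictMonoOn (fun r : ℝ => r - r⁻¹) (Ioi 0) := by
  intro a ha b hb hab
  have := inv_strictAnti₀ (mem_Ioi.1 ha) hab
  simp only
  linarith

/-- Equal imaginary parts put both points on one curve `bentCoord`, whose monotonicity yields equal
arguments; then `r - 1/r`, and so `r`, agrees as well. -/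
lemma injOn_harmonicMap_generic (hβ : β ∈ Ioo 0 Real.pi)
    (H : IsNormalizedShear (slitMap (2 * Real.cos β)) sqDilatation h g) :
    InjOn (harmonicMap h g) disk := by
  intro z hz z' hz' hzz
  have hs := Real.sin_pos_of_mem_Ioo hβ
  have hV := halfPlaneCoord_im_neg hs hz
  have hV' := halfPlaneCoord_im_neg hs hz'
  have h1 := harmonicMap_re_bentCoord hβ H hz rfl
  have h2 := harmonicMap_re_bentCoord hβ H hz' rfl
  rw [← hzz, h1] at h2
  have harg := (bentCoord_strictMono (abs_cos_lt_one hβ)).injective h2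
  have h3 := harmonicMap_im_halfPlane hβ H hz rfl
  have h4 := harmonicMap_im_halfPlane hβ H hz' rfl
  have hx := arg_mem_Ioo hV
  have hsin := Real.sin_neg_of_neg_of_neg_pi_lt hx.2 hx.1
  rw [← hzz, h3, ← harg] at h4
  have hn : ‖halfPlaneCoord β z‖ = ‖halfPlaneCoord β z'‖ := by
    refine strictMonoOn_sub_inv.injOn (norm_pos_of_im_neg hV) (norm_pos_of_im_neg hV') ?_
    have h5 := mul_left_cancel₀ hsin.ne h4
    linarith
  exact halfPlaneCoord_injOn hs hz hz' (Complex.ext_norm_arg hn harg)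

lemma image_harmonicMap_generic (hβ : β ∈ Ioo 0 Real.pi)
    (H : IsNormalizedShear (slitMap (2 * Real.cos β)) sqDilatation h g) :
    harmonicMap h g '' disk = shearDomain β := by
  have hs := Real.sin_pos_of_mem_Ioo hβ
  have hmem : ∀ w : ℂ, w ∈ shearDomain β ↔
      ∃ x ∈ Ioo (-Real.pi) 0, bentCoord (Real.cos β) (2 * Real.sin β ^ 2 * w.im) x =
        2 * Real.sin β ^ 3 * w.re - β + Real.sin β * Real.cos β := by
    intro w
    rw [exists_bentCoord_eq_iff (abs_cos_lt_one hβ), abs_mul,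
      abs_of_pos (by positivity : 0 < 2 * Real.sin β ^ 2)]
    simp only [shearDomain, LeftOfBoundary, mem_ofPred_eq, hβ.1.ne', if_false,
      sub_ne_zero.2 hβ.2.ne', Real.sin_pi_sub, Real.cos_pi_sub, neg_re, neg_im, abs_neg, mem_Ioo]
    constructor
    · rintro ⟨h1, h2⟩; constructor <;> linarith
    · rintro ⟨h1, h2⟩; constructor <;> linarith
  ext w
  rw [hmem]
  constructor
  · rintro ⟨z, hz, rfl⟩
    exact ⟨_, arg_mem_Ioo (halfPlaneCoord_im_neg hs hz),
      (harmonicMap_re_bentCoord hβ H hz rfl).symm⟩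
  · rintro ⟨x, hx, hxw⟩
    have hsin := Real.sin_neg_of_neg_of_neg_pi_lt hx.2 hx.1
    -- The imaginary part prescribes `m = (r - 1/r)/2`. Then `q = (r + 1/r)/2`, so `r = m + q` and
    -- `1/r = q - m`.
    set m := 2 * Real.sin β ^ 2 * w.im / Real.sin x with hm
    set q := √(m ^ 2 + 1) with hq
    have hq2 : q ^ 2 = m ^ 2 + 1 := Real.sq_sqrt (by positivity)
    have hr : 0 < m + q := by
      have : |m| < q := by
        rw [hq, ← Real.sqrt_sq_eq_abs]
        exact Real.sqrt_lt_sqrt (sq_nonneg _) (by linarith)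
      linarith [neg_abs_le m]
    have hinv : (m + q)⁻¹ = q - m := by
      rw [inv_eq_iff_eq_inv, eq_comm]
      refine inv_eq_of_mul_eq_one_left ?_
      linear_combination hq2
    have hxmem : x ∈ Ioc (-Real.pi) Real.pi := ⟨hx.1, by linarith [hx.2, Real.pi_pos]⟩
    obtain ⟨V, hVn, hVa⟩ : ∃ V : ℂ, ‖V‖ = m + q ∧ V.arg = x := by
      refine ⟨(m + q : ℝ) * (cos x + sin x * I), ?_, arg_mul_cos_add_sin_mul_I hr hxmem⟩
      rw [← exp_mul_I, norm_mul, norm_exp_ofReal_mul_I, norm_real, Real.norm_eq_abs,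
        abs_of_pos hr, mul_one]
    have hVim : V.im < 0 := arg_neg_iff.1 (hVa ▸ hx.2)
    obtain ⟨z, hz, hzV⟩ := exists_halfPlaneCoord_eq hs hVim
    have him := harmonicMap_im_halfPlane hβ H hz hzV
    have hre := harmonicMap_re_bentCoord hβ H hz hzV
    rw [hVn, hVa, hinv] at him
    have h1 : (harmonicMap h g z).im = w.im := by
      have h2 : Real.sin x * m = 2 * Real.sin β ^ 2 * w.im := by
        rw [hm, mul_div_cancel₀ _ hsin.ne]
      have h3 : (2 * Real.sin β ^ 2) * (harmonicMap h g z).im = (2 * Real.sin β ^ 2) * w.im := by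
        rw [him, ← h2]; ring
      exact mul_left_cancel₀ (by positivity) h3
    rw [hVa, h1, hxw] at hre
    refine ⟨z, hz, Complex.ext ?_ h1⟩
    have h3 : (2 * Real.sin β ^ 3) * (harmonicMap h g z).re = (2 * Real.sin β ^ 3) * w.re := by
      linarith
    exact mul_left_cancel₀ (by positivity) h3

end Generic

/-! ### The slit planes -/

section Slit

variable {δ : ℝ} {h g : ℂ → ℂ}

/-- The Möbius transformation of the disk onto the right half-plane. -/
def cayley (δ : ℝ) (z : ℂ) : ℂ := (1 - δ * z) / (1 + δ * z)

lemma ofReal_sq_eq_one (hδ : δ ^ 2 = 1) : (δ : ℂ) ^ 2 = 1 := by exact_mod_cast hδ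

lemma one_add_mul_ne_zero (hδ : δ ^ 2 = 1) {z : ℂ} (hz : z ∈ disk) : 1 + (δ : ℂ) * z ≠ 0 := by
  intro h
  apply one_sub_sq_ne_zero hz
  linear_combination (1 - δ * z) * h + z ^ 2 * ofReal_sq_eq_one hδ

lemma slitDen_two_mul (hδ : δ ^ 2 = 1) (z : ℂ) :
    slitDen (2 * δ) z = (1 + δ * z) ^ 2 := by
  simp only [slitDen, ofReal_mul, ofReal_ofNat]
  linear_combination (-z ^ 2) * ofReal_sq_eq_one hδ

lemma two_mul_mem_Icc (hδ : δ ^ 2 = 1) : 2 * δ ∈ Icc (-2 : ℝ) 2 := by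
  constructor <;> nlinarith

lemma cayley_re_pos (hδ : δ ^ 2 = 1) {z : ℂ} (hz : z ∈ disk) : 0 < (cayley δ z).re := by
  have h0 := normSq_pos.2 (one_add_mul_ne_zero hδ hz)
  rw [mem_disk_iff, normSq_apply] at hz
  rw [cayley, div_re, ← add_div]
  refine div_pos ?_ h0
  simp
  nlinarith

lemma cayley_injOn (hδ : δ ^ 2 = 1) : InjOn (cayley δ) disk := by
  intro z hz w hw h
  rw [cayley, cayley, div_eq_div_iff (one_add_mul_ne_zero hδ hz)
    (one_add_mul_ne_zero hδ hw)] at h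
  linear_combination (-δ / 2) * h + (w - z) * ofReal_sq_eq_one hδ

lemma exists_cayley_eq (hδ : δ ^ 2 = 1) {ζ : ℂ} (hζ : 0 < ζ.re) :
    ∃ z ∈ disk, cayley δ z = ζ := by
  have hn : normSq (1 - ζ) < normSq (1 + ζ) := by
    simp [normSq_apply]; nlinarith
  have hne : 1 + ζ ≠ 0 := normSq_pos.1 ((normSq_nonneg _).trans_lt hn)
  have hz : (δ : ℂ) * ((1 - ζ) / (1 + ζ)) ∈ disk := by
    rw [mem_disk_iff, map_mul, map_div₀, normSq_ofReal, ← sq, hδ, one_mul,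
      div_lt_one (normSq_pos.2 hne)]
    exact hn
  refine ⟨_, hz, ?_⟩
  have h2 : (δ : ℂ) * (δ * ((1 - ζ) / (1 + ζ))) = (1 - ζ) / (1 + ζ) := by
    linear_combination (1 - ζ) / (1 + ζ) * ofReal_sq_eq_one hδ
  have h3 := one_add_mul_ne_zero hδ hz
  rw [h2] at h3
  rw [cayley, h2, div_eq_iff h3]
  field_simp
  ring

lemma slitMap_eq_cayley (hδ : δ ^ 2 = 1) {z : ℂ} (hz : z ∈ disk) :
    slitMap (2 * δ) z = δ * ((1 - cayley δ z ^ 2) / 4) := by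
  have ha := one_add_mul_ne_zero hδ hz
  change z / slitDen (2 * δ) z = _
  have hz1 : z = δ * (1 + δ * z - 1) := by linear_combination (-z) * ofReal_sq_eq_one hδ
  rw [slitDen_two_mul hδ, cayley, show 1 - δ * z = 2 - (1 + δ * z) by ring]
  generalize 1 + δ * z = a at *
  field_simp
  linear_combination 4 * hz1

lemma hasDerivAt_cayley (hδ : δ ^ 2 = 1) {z : ℂ} (hz : z ∈ disk) :
    HasDerivAt (cayley δ) (-2 * δ / (1 + δ * z) ^ 2) z := by
  have := (((hasDerivAt_id z).const_mul (δ : ℂ)).const_sub 1).div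
    (((hasDerivAt_id z).const_mul (δ : ℂ)).const_add 1) (one_add_mul_ne_zero hδ hz)
  refine this.congr_deriv ?_
  simp only [id]
  congr 1
  ring

lemma shear_add_eq_cayley (hδ : δ ^ 2 = 1)
    (H : IsNormalizedShear (slitMap (2 * δ)) sqDilatation h g) {z : ℂ} (hz : z ∈ disk) :
    h z + g z = δ * (1 / 3 - cayley δ z / 4 - cayley δ z ^ 3 / 12) := by
  refine H.add_eq (two_mul_mem_Icc hδ)
    (k := fun z => δ * (1 / 3 - cayley δ z / 4 - cayley δ z ^ 3 / 12)) (fun z hz => ?_) ?_ hz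
  · have hd := hasDerivAt_cayley hδ hz
    have := ((((hd.div_const 4).const_sub (1 / 3)).sub ((hd.pow 3).div_const 12)).const_mul
      (δ : ℂ))
    refine this.congr_deriv ?_
    have ha := one_add_mul_ne_zero hδ hz
    have h4 := ofReal_sq_eq_one hδ
    have hz1 : z ^ 2 = (1 + δ * z - 1) ^ 2 := by linear_combination (-z ^ 2) * h4
    rw [slitDen_two_mul hδ, cayley, show 1 - δ * z = 2 - (1 + δ * z) by ring, hz1]
    clear hd this hz1
    generalize 1 + δ * z = a at *
    push_cast
    field_simp
    linear_combination 24 * (a ^ 2 + (2 - a) ^ 2) * h4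
  · simp [cayley]; norm_num

lemma harmonicMap_im_cayley (hδ : δ ^ 2 = 1)
    (H : IsNormalizedShear (slitMap (2 * δ)) sqDilatation h g) {z ζ : ℂ} (hz : z ∈ disk)
    (hζ : cayley δ z = ζ) : (harmonicMap h g z).im = -δ * (ζ.re * ζ.im / 2) := by
  rw [H.harmonicMap_im hz, slitMap_eq_cayley hδ hz, hζ, im_ofReal_mul, ← ofReal_ofNat,
    div_ofReal_im]
  simp [sq]
  ring

/-- With `ζ = x + iy` and `v = Im f = -δxy/2`, the term `xy²/4` from `Re ζ³` equals `v²/x`, leaving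
a function of `x` alone on each horizontal line. -/
lemma harmonicMap_re_cayley (hδ : δ ^ 2 = 1)
    (H : IsNormalizedShear (slitMap (2 * δ)) sqDilatation h g) {z ζ : ℂ} (hz : z ∈ disk)
    (hζ : cayley δ z = ζ) :
    δ * (harmonicMap h g z).re =
      1 / 3 - ζ.re / 4 - ζ.re ^ 3 / 12 + (harmonicMap h g z).im ^ 2 / ζ.re := by
  have hpos : 0 < ζ.re := hζ ▸ cayley_re_pos hδ hz
  have h1 : (1 / 3 - ζ / 4 - ζ ^ 3 / 12).re =
      1 / 3 - ζ.re / 4 - (ζ.re ^ 3 - 3 * ζ.re * ζ.im ^ 2) / 12 := by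
    have : (1 / 3 - ζ / 4 - ζ ^ 3 / 12 : ℂ) = ((1 / 3 : ℝ) : ℂ) - ζ / (4 : ℝ) -
      ζ ^ 3 / (12 : ℝ) := by push_cast; ring
    rw [this]
    simp only [sub_re, div_ofReal_re, ofReal_re, pow_succ, pow_zero, one_mul, mul_re, mul_im]
    ring
  rw [harmonicMap_im_cayley hδ H hz hζ, IsNormalizedShear.harmonicMap_re,
    shear_add_eq_cayley hδ H hz, hζ, re_ofReal_mul, h1]
  field_simp
  linear_combination (192 - 144 * ζ.re - 48 * ζ.re ^ 3) * hδ

lemma strictAntiOn_slitCoord (v : ℝ) :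
    StrictAntiOn (fun x : ℝ => 1 / 3 - x / 4 - x ^ 3 / 12 + v ^ 2 / x) (Ioi 0) := by
  intro a ha b hb hab
  rw [mem_Ioi] at ha hb
  have h1 : v ^ 2 / b ≤ v ^ 2 / a := div_le_div_of_nonneg_left (sq_nonneg v) ha hab.le
  have h2 : a ^ 3 < b ^ 3 := pow_lt_pow_left₀ hab ha.le (by norm_num)
  simp only
  linarith

/-- Intermediate values: the function tends to `-∞` at infinity, and near `0` it tends to `+∞` if `v
≠ 0` but only to `1/3` if `v = 0`. The latter bound creates the slit. -/
lemma exists_slitCoord_eq {v t : ℝ} (h : v = 0 → t < 1 / 3) :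
    ∃ x ∈ Ioi (0 : ℝ), 1 / 3 - x / 4 - x ^ 3 / 12 + v ^ 2 / x = t := by
  have hcont : ContinuousOn (fun x : ℝ => 1 / 3 - x / 4 - x ^ 3 / 12 + v ^ 2 / x) (Ioi 0) := by
    refine ContinuousOn.add (by fun_prop) (continuousOn_const.div continuousOn_id ?_)
    intro x hx; exact (mem_Ioi.1 hx).ne'
  obtain ⟨a, ha, hat⟩ : ∃ a ∈ Ioi (0 : ℝ), t ≤ 1 / 3 - a / 4 - a ^ 3 / 12 + v ^ 2 / a := by
    by_cases hv : v = 0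
    · have ht := h hv
      refine ⟨min 1 (1 / 3 - t), lt_min one_pos (sub_pos.2 ht), ?_⟩
      set a := min 1 (1 / 3 - t)
      have h0 : 0 < a := lt_min one_pos (sub_pos.2 ht)
      have h1 : a ≤ 1 := min_le_left _ _
      have h2 : a ≤ 1 / 3 - t := min_le_right _ _
      have h3 : a ^ 3 ≤ a := by
        simpa using pow_le_pow_of_le_one h0.le h1 (show 1 ≤ 3 by norm_num)
      simp [hv]; linarith
    · have hv2 : 0 < v ^ 2 := by positivity
      have hq : 0 < v ^ 2 / (|t| + 1) := by positivity
      refine ⟨min 1 (v ^ 2 / (|t| + 1)), lt_min one_pos hq, ?_⟩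
      set a := min 1 (v ^ 2 / (|t| + 1))
      have h0 : 0 < a := lt_min one_pos hq
      have h1 : a ≤ 1 := min_le_left _ _
      have h2 : a ≤ v ^ 2 / (|t| + 1) := min_le_right _ _
      have h3 : a ^ 3 ≤ 1 := pow_le_one₀ h0.le h1
      have h4 : |t| + 1 ≤ v ^ 2 / a := by
        rw [le_div_iff₀ h0, mul_comm]
        exact (le_div_iff₀ (by positivity)).1 h2
      linarith [le_abs_self t]
  obtain ⟨b, hb, hbt⟩ : ∃ b ∈ Ioi (0 : ℝ), 1 / 3 - b / 4 - b ^ 3 / 12 + v ^ 2 / b ≤ t := by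
    refine ⟨4 * (|t| + v ^ 2) + 4, by rw [mem_Ioi]; positivity, ?_⟩
    set b := 4 * (|t| + v ^ 2) + 4 with hb
    have h1 : 1 ≤ b := by
      have : 0 ≤ |t| + v ^ 2 := by positivity
      linarith
    have h2 : v ^ 2 / b ≤ v ^ 2 := div_le_self (sq_nonneg v) h1
    have h3 : 0 ≤ b ^ 3 := by positivity
    linarith [neg_abs_le t]
  exact ordConnected_Ioi.isPreconnected.intermediate_value hb ha hcont ⟨hbt, hat⟩

lemma injOn_harmonicMap_slit (hδ : δ ^ 2 = 1)
    (H : IsNormalizedShear (slitMap (2 * δ)) sqDilatation h g) :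
    InjOn (harmonicMap h g) disk := by
  intro z hz z' hz' hzz
  have hp := cayley_re_pos hδ hz
  have hp' := cayley_re_pos hδ hz'
  have h1 := harmonicMap_re_cayley hδ H hz rfl
  have h2 := harmonicMap_re_cayley hδ H hz' rfl
  rw [← hzz, h1] at h2
  have hre := (strictAntiOn_slitCoord _).injOn hp hp' h2
  have h3 := harmonicMap_im_cayley hδ H hz rfl
  have h4 := harmonicMap_im_cayley hδ H hz' rfl
  rw [← hzz, h3, ← hre] at h4
  have hδ0 : -δ ≠ 0 := by
    intro h0; rw [neg_eq_zero] at h0; simp [h0] at hδ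
  have h5 := mul_left_cancel₀ hδ0 h4
  have him : (cayley δ z).im = (cayley δ z').im :=
    mul_left_cancel₀ hp.ne' (by linarith)
  exact cayley_injOn hδ hz hz' (Complex.ext hre him)

lemma image_harmonicMap_slit (hδ : δ ^ 2 = 1)
    (H : IsNormalizedShear (slitMap (2 * δ)) sqDilatation h g) :
    harmonicMap h g '' disk = {w | w.im = 0 → δ * w.re < 1 / 3} := by
  ext w
  constructor
  · rintro ⟨z, hz, rfl⟩ h0
    have hp := cayley_re_pos hδ hz
    rw [harmonicMap_re_cayley hδ H hz rfl, h0]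
    have : 0 < (cayley δ z).re ^ 3 := by positivity
    simp; linarith
  · intro hw
    obtain ⟨x, hx, hxw⟩ := exists_slitCoord_eq hw
    have hx0 : (0 : ℝ) < x := hx
    -- The ordinate solves `-δxy/2 = w.im`, using `δ² = 1`.
    obtain ⟨z, hz, hzζ⟩ := exists_cayley_eq hδ (ζ := ⟨x, -2 * δ * w.im / x⟩) hx0
    have him : (harmonicMap h g z).im = w.im := by
      rw [harmonicMap_im_cayley hδ H hz hzζ]
      field_simp
      linear_combination w.im * hδ
    have hre := harmonicMap_re_cayley hδ H hz hzζ
    simp only [him] at hre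
    rw [hxw] at hre
    refine ⟨z, hz, Complex.ext ?_ him⟩
    have hδ0 : δ ≠ 0 := by intro h0; simp [h0] at hδ
    exact mul_left_cancel₀ hδ0 hre

end Slit

lemma leftOfBoundary_pi (w : ℂ) : LeftOfBoundary Real.pi w := by
  simp [LeftOfBoundary, Real.pi_ne_zero, Real.pi_pos]

theorem injOn_and_image_harmonicMap {β : ℝ} (hβ : β ∈ Icc 0 Real.pi) {h g : ℂ → ℂ}
    (H : IsNormalizedShear (slitMap (2 * Real.cos β)) sqDilatation h g) :
    InjOn (harmonicMap h g) disk ∧ harmonicMap h g '' disk = shearDomain β := by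
  rcases eq_or_lt_of_le hβ.1 with h0 | h0
  · subst h0
    rw [Real.cos_zero] at H
    refine ⟨injOn_harmonicMap_slit (by norm_num) H, ?_⟩
    rw [image_harmonicMap_slit (by norm_num) H]
    ext w
    simp [shearDomain, leftOfBoundary_pi]
    simp [LeftOfBoundary]
  rcases eq_or_lt_of_le hβ.2 with h1 | h1
  · subst h1
    rw [Real.cos_pi] at H
    refine ⟨injOn_harmonicMap_slit (by norm_num) H, ?_⟩
    rw [image_harmonicMap_slit (by norm_num) H]
    ext w
    simp [shearDomain, leftOfBoundary_pi]
    simp [LeftOfBoundary]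
  exact ⟨injOn_harmonicMap_generic ⟨h0, h1⟩ H, image_harmonicMap_generic ⟨h0, h1⟩ H⟩

/-! ### Kernel convergence of the image domains -/

/-- The right end of the real slice of the image domain. -/
def rightEnd (β : ℝ) : ℝ := (β - Real.sin β * Real.cos β) / (2 * Real.sin β ^ 3)

/-- L'Hôpital once: the derivatives are `2 sin²β` and `6 sin²β cos β`, with quotient `1 / (3 cos
β)`. -/
lemma tendsto_rightEnd : Tendsto rightEnd (𝓝[>] 0) (𝓝 (1 / 3)) := by
  have hsmall : ∀ᶠ β : ℝ in 𝓝[>] 0, β ∈ Ioo 0 (Real.pi / 2) :=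
    Ioo_mem_nhdsGT (by positivity)
  have hcont : ∀ {f : ℝ → ℝ}, Continuous f → Tendsto f (𝓝[>] 0) (𝓝 (f 0)) :=
    fun hf => (hf.tendsto 0).mono_left nhdsWithin_le_nhds
  refine HasDerivAt.lhopital_zero_nhdsGT (f' := fun β => 2 * Real.sin β ^ 2)
    (g' := fun β => 6 * Real.sin β ^ 2 * Real.cos β) (Eventually.of_forall fun β => ?_)
    (Eventually.of_forall fun β => ?_) ?_ ?_ ?_ ?_
  · refine ((hasDerivAt_id β).sub
      ((Real.hasDerivAt_sin β).mul (Real.hasDerivAt_cos β))).congr_deriv ?_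
    linear_combination -(Real.sin_sq_add_cos_sq β)
  · refine (((Real.hasDerivAt_sin β).pow 3).const_mul 2).congr_deriv ?_
    simp; ring
  · filter_upwards [hsmall] with β hβ
    have h1 := Real.sin_pos_of_pos_of_lt_pi hβ.1 (by linarith [hβ.2, Real.pi_pos])
    have h2 := Real.cos_pos_of_mem_Ioo ⟨by linarith [hβ.1, hβ.2], hβ.2⟩
    positivity
  · have := hcont (f := fun β => β - Real.sin β * Real.cos β) (by fun_prop)
    simpa using this
  · have := hcont (f := fun β => 2 * Real.sin β ^ 3) (by fun_prop)
    simpa using this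
  · have h1 : Tendsto (fun β => 1 / (3 * Real.cos β)) (𝓝[>] 0) (𝓝 (1 / 3)) := by
      have : Tendsto (fun β => 3 * Real.cos β) (𝓝[>] 0) (𝓝 3) := by
        simpa using hcont (f := fun β => 3 * Real.cos β) (by fun_prop)
      exact tendsto_const_nhds.div this (by norm_num)
    refine h1.congr' ?_
    filter_upwards [hsmall] with β hβ
    have h1 := Real.sin_pos_of_pos_of_lt_pi hβ.1 (by linarith [hβ.2, Real.pi_pos])
    have h2 := Real.cos_pos_of_mem_Ioo ⟨by linarith [hβ.1, hβ.2], hβ.2⟩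
    field_simp
    norm_num

/-- Dividing by `2 sin²β` gives a form that survives `β → 0`: off the real axis it degenerates to `0
< |Im w|`, and on the axis it reads `Re w < rightEnd β`. -/
lemma leftOfBoundary_iff {β : ℝ} (hβ : β ∈ Ioo 0 Real.pi) (w : ℂ) :
    LeftOfBoundary β w ↔ Real.sin β * (w.re - rightEnd β) < Real.cos β * |w.im| := by
  have hs := Real.sin_pos_of_mem_Ioo hβ
  have h1 : β - Real.sin β * Real.cos β = 2 * Real.sin β ^ 3 * rightEnd β := by
    rw [rightEnd, mul_div_cancel₀ _ (by positivity)]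
  have h2 : 0 < 2 * Real.sin β ^ 2 := by positivity
  rw [LeftOfBoundary, if_neg hβ.1.ne', h1, ← mul_lt_mul_iff_right₀ h2 (b := Real.sin β * _)]
  constructor <;> intro h <;> nlinarith

/-- Separates `β = 0`, where `LeftOfBoundary` has its own clause, from the approach to it. -/
lemma nhdsWithin_Icc_zero_le :
    𝓝[Icc 0 Real.pi] (0 : ℝ) ≤ pure 0 ⊔ 𝓝[Ioo 0 Real.pi] 0 := by
  rw [← nhdsWithin_singleton, ← nhdsWithin_union]
  have : 𝓝[Icc 0 Real.pi] (0 : ℝ) = 𝓝[Ico 0 Real.pi] 0 := by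
    rw [nhdsWithin_Icc_eq_nhdsGE Real.pi_pos, nhdsWithin_Ico_eq_nhdsGE Real.pi_pos]
  rw [this]
  refine nhdsWithin_mono _ fun x hx => ?_
  rcases eq_or_lt_of_le hx.1 with h | h
  · left; exact h.symm
  · right; exact ⟨h, hx.2⟩

lemma tendsto_rightEnd_Ioo : Tendsto rightEnd (𝓝[Ioo 0 Real.pi] 0) (𝓝 (1 / 3)) :=
  tendsto_rightEnd.mono_left (nhdsWithin_mono _ fun _ hx => hx.1)

/-- Openness jointly in parameter and point: it yields open image domains and, by compactness, the
inclusion of the limit domain in the kernel. -/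
lemma eventually_leftOfBoundary {β₀ : ℝ} {w₀ : ℂ} (h : LeftOfBoundary β₀ w₀) :
    ∀ᶠ q : ℝ × ℂ in 𝓝[Icc 0 Real.pi] β₀ ×ˢ 𝓝 w₀, LeftOfBoundary q.1 q.2 := by
  by_cases h0 : β₀ = 0
  · subst h0
    refine Filter.Eventually.filter_mono (prod_mono_left _ nhdsWithin_Icc_zero_le) ?_
    rw [sup_prod, eventually_sup, pure_prod, eventually_map]
    simp only [LeftOfBoundary, if_true] at h
    have him : Tendsto (fun q : ℝ × ℂ => q.2.im) (𝓝[Ioo 0 Real.pi] 0 ×ˢ 𝓝 w₀) (𝓝 w₀.im) :=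
      (continuous_im.tendsto w₀).comp tendsto_snd
    have hre : Tendsto (fun q : ℝ × ℂ => q.2.re) (𝓝[Ioo 0 Real.pi] 0 ×ˢ 𝓝 w₀) (𝓝 w₀.re) :=
      (continuous_re.tendsto w₀).comp tendsto_snd
    have hend : Tendsto (fun q : ℝ × ℂ => rightEnd q.1) (𝓝[Ioo 0 Real.pi] 0 ×ˢ 𝓝 w₀)
        (𝓝 (1 / 3)) := tendsto_rightEnd_Ioo.comp tendsto_fst
    have hfst : Tendsto (fun q : ℝ × ℂ => q.1) (𝓝[Ioo 0 Real.pi] 0 ×ˢ 𝓝 w₀) (𝓝 0) :=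
      tendsto_fst.mono_right nhdsWithin_le_nhds
    have hmem : ∀ᶠ q : ℝ × ℂ in 𝓝[Ioo 0 Real.pi] 0 ×ˢ 𝓝 w₀, q.1 ∈ Ioo 0 Real.pi :=
      tendsto_fst.eventually (eventually_mem_nhdsWithin (s := Ioo 0 Real.pi))
    have hcos : Tendsto (fun q : ℝ × ℂ => Real.cos q.1) (𝓝[Ioo 0 Real.pi] 0 ×ˢ 𝓝 w₀)
        (𝓝 1) := by
      simpa [Function.comp_def] using (Real.continuous_cos.tendsto 0).comp hfst
    have hsin : Tendsto (fun q : ℝ × ℂ => Real.sin q.1) (𝓝[Ioo 0 Real.pi] 0 ×ˢ 𝓝 w₀)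
        (𝓝 0) := by
      simpa [Function.comp_def] using (Real.continuous_sin.tendsto 0).comp hfst
    by_cases hv : w₀.im = 0
    · have hw := h hv
      constructor
      · filter_upwards [continuous_re.continuousAt.eventually_lt continuousAt_const hw] with w hw'
        simp only [LeftOfBoundary, if_true]
        exact fun _ => hw'
      · filter_upwards [hre.eventually_lt hend hw, hmem,
          hcos.eventually (lt_mem_nhds one_pos)] with q hq hq1 hq2
        rw [leftOfBoundary_iff hq1]
        have hs := Real.sin_pos_of_mem_Ioo hq1
        calc _ < 0 := mul_neg_of_pos_of_neg hs (sub_neg.2 hq)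
          _ ≤ _ := mul_nonneg hq2.le (abs_nonneg _)
    · constructor
      · filter_upwards [continuous_im.continuousAt.eventually_ne hv] with w hw'
        simp only [LeftOfBoundary, if_true]
        exact fun h' => absurd h' hw'
      · have hl := hsin.mul (hre.sub hend)
        have hr := hcos.mul him.abs
        filter_upwards [hl.eventually_lt hr (by simpa using hv), hmem] with q hq hq1
        exact (leftOfBoundary_iff hq1 _).2 hq
  · rw [LeftOfBoundary, if_neg h0] at h
    refine Filter.Eventually.filter_mono (prod_mono_left _ nhdsWithin_le_nhds) ?_
    rw [← nhds_prod_eq]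
    have hl : Continuous fun q : ℝ × ℂ => 2 * Real.sin q.1 ^ 3 * q.2.re := by fun_prop
    have hr : Continuous fun q : ℝ × ℂ => q.1 - Real.sin q.1 * Real.cos q.1 +
        2 * Real.cos q.1 * Real.sin q.1 ^ 2 * |q.2.im| := by fun_prop
    filter_upwards [hl.continuousAt.eventually_lt (x₀ := (β₀, w₀)) hr.continuousAt h,
      continuous_fst.continuousAt.eventually_ne (x := (β₀, w₀)) h0] with q hq hq0
    rw [LeftOfBoundary, if_neg hq0]
    exact hq

/-- A point on the limiting boundary may lie inside nearby domains; the shift by `ε` moves it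
strictly past the boundary. -/
lemma eventually_not_leftOfBoundary {β₀ : ℝ} (hβ₀ : β₀ ∈ Icc 0 Real.pi) {w₀ : ℂ}
    (h : ¬ LeftOfBoundary β₀ w₀) {ε : ℝ} (hε : 0 < ε) :
    ∀ᶠ β in 𝓝[Icc 0 Real.pi] β₀, ¬ LeftOfBoundary β (w₀ + ε) := by
  have hre : (w₀ + ε).re = w₀.re + ε := by simp
  have him : (w₀ + ε).im = w₀.im := by simp
  by_cases h0 : β₀ = 0
  · subst h0
    simp only [LeftOfBoundary, if_true, Classical.not_imp, not_lt] at h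
    refine Filter.Eventually.filter_mono nhdsWithin_Icc_zero_le ?_
    rw [eventually_sup, eventually_pure]
    constructor
    · simp only [LeftOfBoundary, if_true, Classical.not_imp, not_lt, hre, him]
      exact ⟨h.1, by linarith [h.2]⟩
    · filter_upwards [tendsto_rightEnd_Ioo.eventually (gt_mem_nhds
        (lt_add_of_pos_right (1 / 3) hε)), eventually_mem_nhdsWithin (s := Ioo 0 Real.pi)] with β h1 h2
      rw [leftOfBoundary_iff h2, hre, him, h.1, abs_zero, mul_zero, not_lt]
      exact mul_nonneg (Real.sin_pos_of_mem_Ioo h2).le (by linarith [h.2])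
  · have hπ : β₀ ≠ Real.pi := fun h' => h (h' ▸ leftOfBoundary_pi w₀)
    have hs := Real.sin_pos_of_mem_Ioo (x := β₀)
      ⟨lt_of_le_of_ne hβ₀.1 (Ne.symm h0), lt_of_le_of_ne hβ₀.2 hπ⟩
    rw [LeftOfBoundary, if_neg h0, not_lt] at h
    refine Filter.Eventually.filter_mono nhdsWithin_le_nhds ?_
    have hl : Continuous fun β : ℝ => 2 * Real.sin β ^ 3 * (w₀.re + ε) := by fun_prop
    have hr : Continuous fun β : ℝ => β - Real.sin β * Real.cos β +
        2 * Real.cos β * Real.sin β ^ 2 * |w₀.im| := by fun_prop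
    have hlt : β₀ - Real.sin β₀ * Real.cos β₀ + 2 * Real.cos β₀ * Real.sin β₀ ^ 2 * |w₀.im| <
        2 * Real.sin β₀ ^ 3 * (w₀.re + ε) := by
      have : 0 < 2 * Real.sin β₀ ^ 3 * ε := by positivity
      linarith
    filter_upwards [hr.continuousAt.eventually_lt hl.continuousAt hlt,
      continuousAt_id.eventually_ne (x := β₀) h0] with β hβ hβ0
    rw [LeftOfBoundary, if_neg (by exact hβ0), hre, him, not_lt]
    exact hβ.le

lemma tendsto_pi_sub_nhdsWithin (β₀ : ℝ) :
    Tendsto (fun β => Real.pi - β) (𝓝[Icc 0 Real.pi] β₀) (𝓝[Icc 0 Real.pi] (Real.pi - β₀)) :=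
  (continuous_const.sub continuous_id).continuousWithinAt.tendsto_nhdsWithin
    fun _ hβ => pi_sub_mem_Icc hβ

lemma eventually_mem_shearDomain {β₀ : ℝ} {w₀ : ℂ} (h : w₀ ∈ shearDomain β₀) :
    ∀ᶠ q : ℝ × ℂ in 𝓝[Icc 0 Real.pi] β₀ ×ˢ 𝓝 w₀, q.2 ∈ shearDomain q.1 :=
  (eventually_leftOfBoundary h.1).and
    (((tendsto_pi_sub_nhdsWithin β₀).prodMap (continuous_neg.tendsto w₀)).eventually
      (eventually_leftOfBoundary h.2))

lemma isOpen_shearDomain {β : ℝ} (hβ : β ∈ Icc 0 Real.pi) : IsOpen (shearDomain β) := by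
  rw [isOpen_iff_mem_nhds]
  intro w hw
  have ht : Tendsto (fun w' : ℂ => (β, w')) (𝓝 w) (𝓝[Icc 0 Real.pi] β ×ˢ 𝓝 w) :=
    (tendsto_const_pure.mono_right (pure_le_nhdsWithin hβ)).prodMk tendsto_id
  exact ht.eventually (eventually_mem_shearDomain hw)

lemma kernel_shearDomain {b : ℕ → ℝ} {β : ℝ} (hb : ∀ n, b n ∈ Icc 0 Real.pi)
    (hβ : β ∈ Icc 0 Real.pi) (hlim : Tendsto b atTop (𝓝 β))
    (hconn : IsConnected (shearDomain β)) (h0 : (0 : ℂ) ∈ shearDomain β) :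
    kernel (fun n => shearDomain (b n)) 0 = shearDomain β := by
  have hlim' : Tendsto b atTop (𝓝[Icc 0 Real.pi] β) :=
    tendsto_nhdsWithin_iff.2 ⟨hlim, Eventually.of_forall hb⟩
  apply Subset.antisymm
  · rintro w (hw | ⟨U, ⟨hU, -, -, hK⟩, hwU⟩)
    · exact (mem_singleton_iff.1 hw) ▸ h0
    -- If `w` violated the right or left bound, `w + ε` or `w - ε` would eventually leave the
    -- domains, although singletons of `U` must eventually lie in them.
    have hshift : ∃ ε : ℝ, 0 < ε ∧ w + ε ∈ U ∧ w - ε ∈ U := by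
      have h1 : ContinuousAt (fun ε : ℝ => w + ε) 0 := by fun_prop
      have h2 : ContinuousAt (fun ε : ℝ => w - ε) 0 := by fun_prop
      have e1 := h1.eventually_mem (hU.mem_nhds (by simpa using hwU))
      have e2 := h2.eventually_mem (hU.mem_nhds (by simpa using hwU))
      obtain ⟨ε, h, hε⟩ := (((e1.and e2).filter_mono nhdsWithin_le_nhds).and
        (eventually_mem_nhdsWithin (s := Ioi (0 : ℝ)))).exists
      exact ⟨ε, hε, h.1, h.2⟩
    obtain ⟨ε, hε, hp, hm⟩ := hshift
    constructor
    · by_contra hcon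
      obtain ⟨n, h1, h2⟩ := ((hK {w + ε} isCompact_singleton (singleton_subset_iff.2 hp)).and
        (hlim'.eventually (eventually_not_leftOfBoundary hβ hcon hε))).exists
      exact h2 (h1 rfl).1
    · by_contra hcon
      obtain ⟨n, h1, h2⟩ := ((hK {w - ε} isCompact_singleton (singleton_subset_iff.2 hm)).and
        (((tendsto_pi_sub_nhdsWithin β).comp hlim').eventually
          (eventually_not_leftOfBoundary (pi_sub_mem_Icc hβ) hcon hε))).exists
      apply h2
      have h3 := (h1 rfl).2
      rwa [show -(w - (ε : ℂ)) = -w + ε by ring] at h3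
  · intro w hw
    refine Or.inr ⟨shearDomain β, ⟨isOpen_shearDomain hβ, hconn, h0, fun K hK hKU => ?_⟩, hw⟩
    have h1 : ∀ᶠ β' in 𝓝 β, ∀ y ∈ K, β' ∈ Icc 0 Real.pi → y ∈ shearDomain β' := by
      refine hK.eventually_forall_of_forall_eventually fun y hy => ?_
      have h2 := eventually_mem_shearDomain (hKU hy)
      rw [← nhdsWithin_univ y, ← nhdsWithin_prod_eq, eventually_nhdsWithin_iff] at h2
      filter_upwards [h2] with q hq hq1 using hq ⟨hq1, trivial⟩
    filter_upwards [hlim.eventually h1] with n hn y hy using hn y hy (hb n)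

/-- The angle `β` with `c = 2 * cos β`. -/
def angle (c : ℝ) : ℝ := Real.arccos (c / 2)

lemma angle_mem (c : ℝ) : angle c ∈ Icc 0 Real.pi := ⟨Real.arccos_nonneg _, Real.arccos_le_pi _⟩

lemma two_mul_cos_angle {c : ℝ} (hc : c ∈ Icc (-2 : ℝ) 2) : 2 * Real.cos (angle c) = c := by
  rw [angle, Real.cos_arccos] <;> linarith [hc.1, hc.2]

lemma continuous_angle : Continuous angle := Real.continuous_arccos.comp (by fun_prop)

section Shear

variable {c : ℝ} {h g : ℂ → ℂ}

lemma IsNormalizedShear.injOn_and_image (hc : c ∈ Icc (-2 : ℝ) 2)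
    (H : IsNormalizedShear (slitMap c) sqDilatation h g) :
    InjOn (harmonicMap h g) disk ∧ harmonicMap h g '' disk = shearDomain (angle c) := by
  rw [← two_mul_cos_angle hc] at H
  exact injOn_and_image_harmonicMap (angle_mem c) H

lemma IsNormalizedShear.isCHDDomain (hc : c ∈ Icc (-2 : ℝ) 2)
    (H : IsNormalizedShear (slitMap c) sqDilatation h g) :
    IsCHDDomain (harmonicMap h g '' disk) where
  isOpen := (H.injOn_and_image hc).2 ▸ isOpen_shearDomain (angle_mem c)
  isConnected := ⟨⟨_, mem_image_of_mem _ zero_mem_disk⟩,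
    isPreconnected_disk.image _ H.continuousOn⟩
  horizontal := (H.injOn_and_image hc).2 ▸ isPreconnected_shearDomain_horizontal (angle_mem c)

end Shear

lemma kernelConverges_harmonicMap {h g : ℝ → ℂ → ℂ}
    (H : ∀ c ∈ Icc (-2 : ℝ) 2, IsNormalizedShear (slitMap c) sqDilatation (h c) (g c))
    {c : ℕ → ℝ} {c₀ : ℝ} (hc : ∀ n, c n ∈ Icc (-2 : ℝ) 2) (hlim : Tendsto c atTop (𝓝 c₀)) :
    KernelConverges (fun n => harmonicMap (h (c n)) (g (c n)) '' disk) 0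
      (harmonicMap (h c₀) (g c₀) '' disk) := by
  intro φ hφ
  have hc₀ : c₀ ∈ Icc (-2 : ℝ) 2 := isClosed_Icc.mem_of_tendsto hlim (Eventually.of_forall hc)
  have him := ((H c₀ hc₀).injOn_and_image hc₀).2
  have hconn := ((H c₀ hc₀).isCHDDomain hc₀).isConnected
  have h0 : (0 : ℂ) ∈ harmonicMap (h c₀) (g c₀) '' disk :=
    ⟨0, zero_mem_disk, by simp [harmonicMap, (H c₀ hc₀).h_zero, (H c₀ hc₀).g_zero]⟩
  rw [him] at hconn h0
  have hfun : (fun n => harmonicMap (h (c (φ n))) (g (c (φ n))) '' disk) =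
      fun n => shearDomain (angle (c (φ n))) :=
    funext fun n => ((H _ (hc (φ n))).injOn_and_image (hc (φ n))).2
  rw [him]
  simp only [hfun]
  exact kernel_shearDomain (fun n => angle_mem _) (angle_mem c₀)
    ((continuous_angle.tendsto c₀).comp (hlim.comp hφ.tendsto_atTop)) hconn h0

lemma image_harmonicMap_zero {h g : ℂ → ℂ}
    (H : IsNormalizedShear (slitMap 0) sqDilatation h g) :
    harmonicMap h g '' disk = {w : ℂ | |w.re| < Real.pi / 4} := by
  have hπ := Real.pi_pos
  rw [(H.injOn_and_image (by constructor <;> norm_num)).2]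
  have h1 : angle 0 = Real.pi / 2 := by simp [angle]
  ext w
  simp [shearDomain, h1, LeftOfBoundary, hπ.ne', abs_lt]
  rw [if_neg (by linarith : Real.pi - Real.pi / 2 ≠ 0)]
  constructor
  · rintro ⟨h1, h2⟩; constructor <;> linarith
  · rintro ⟨h1, h2⟩; constructor <;> linarith

/-! ### The minimal surface equation -/

lemma fderiv_vec3 {a b d : ℂ → ℝ} {a' b' d' : ℂ →L[ℝ] ℝ} {w : ℂ} (ha : HasFDerivAt a a' w)
    (hb : HasFDerivAt b b' w) (hd : HasFDerivAt d d' w) (v : ℂ) :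
    fderiv ℝ (fun w => (!₂[a w, b w, d w] : E3)) w v = !₂[a' v, b' v, d' v] := by
  have hdiff : DifferentiableAt ℝ (fun w => (!₂[a w, b w, d w] : E3)) w := by
    rw [differentiableAt_euclidean]
    intro i
    fin_cases i
    exacts [ha.differentiableAt, hb.differentiableAt, hd.differentiableAt]
  have h : ∀ i : Fin 3, HasFDerivAt (fun w => (!₂[a w, b w, d w] : E3) i)
      ((EuclideanSpace.proj i).comp (fderiv ℝ (fun w => (!₂[a w, b w, d w] : E3)) w)) w :=
    fun i => (EuclideanSpace.proj (𝕜 := ℝ) i).hasFDerivAt.comp w hdiff.hasFDerivAt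
  ext i
  fin_cases i
  · exact DFunLike.congr_fun ((h 0).unique ha) v
  · exact DFunLike.congr_fun ((h 1).unique hb) v
  · exact DFunLike.congr_fun ((h 2).unique hd) v

/-- A graph satisfying the minimal surface equation at a point has mean curvature zero there. -/
lemma meanCurvature_graphParam_eq_zero {Φ A B : ℂ → ℝ} {U : Set ℂ} (hU : IsOpen U)
    (hΦ : ∀ w ∈ U, HasFDerivAt Φ (A w • reCLM + B w • imCLM) w) {w : ℂ} (hw : w ∈ U)
    {A' B' : ℂ →L[ℝ] ℝ} (hA : HasFDerivAt A A' w) (hB : HasFDerivAt B B' w)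
    (hmse : A' 1 * (1 + B w ^ 2) - 2 * B' 1 * (A w * B w) + B' I * (1 + A w ^ 2) = 0) :
    meanCurvature (graphParam Φ) w = 0 := by
  have hpU : ∀ w ∈ U, pderivU (graphParam Φ) w = !₂[1, 0, A w] := by
    intro w hw
    refine (fderiv_vec3 reCLM.hasFDerivAt imCLM.hasFDerivAt (hΦ w hw) 1).trans ?_
    simp
  have hpV : ∀ w ∈ U, pderivV (graphParam Φ) w = !₂[0, 1, B w] := by
    intro w hw
    refine (fderiv_vec3 reCLM.hasFDerivAt imCLM.hasFDerivAt (hΦ w hw) I).trans ?_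
    simp
  have hnhds := hU.mem_nhds hw
  have eU : pderivU (graphParam Φ) =ᶠ[𝓝 w] fun w => !₂[1, 0, A w] := by
    filter_upwards [hnhds] with w hw using hpU w hw
  have eV : pderivV (graphParam Φ) =ᶠ[𝓝 w] fun w => !₂[0, 1, B w] := by
    filter_upwards [hnhds] with w hw using hpV w hw
  have hc : ∀ t : ℝ, HasFDerivAt (fun _ : ℂ => t) (0 : ℂ →L[ℝ] ℝ) w :=
    fun t => hasFDerivAt_const t w
  have hUU : pderivU (pderivU (graphParam Φ)) w = !₂[0, 0, A' 1] := by
    rw [pderivU, eU.fderiv_eq, fderiv_vec3 (hc 1) (hc 0) hA]; simp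
  have hUV : pderivU (pderivV (graphParam Φ)) w = !₂[0, 0, B' 1] := by
    rw [pderivU, eV.fderiv_eq, fderiv_vec3 (hc 0) (hc 1) hB]; simp
  have hVV : pderivV (pderivV (graphParam Φ)) w = !₂[0, 0, B' I] := by
    rw [pderivV, eV.fderiv_eq, fderiv_vec3 (hc 0) (hc 1) hB]; simp
  simp only [meanCurvature, unitNormal, hUU, hUV, hVV, hpU w hw, hpV w hw, cross, inner_smul_right]
  simp [PiLp.inner_apply, Fin.sum_univ_three, crossProduct, EuclideanSpace.real_norm_sq_eq]
  -- The quotient vanishes through its numerator, which is the minimal surface equation divided by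
  -- the length of the normal.
  left
  linear_combination
    ‖WithLp.toLp 2 ![-A w, -B w, 1]‖⁻¹ * hmse

/-! ### The inverse of a harmonic mapping with dilatation `z ^ 2` -/

/-- The real differential of a harmonic mapping with `h' = a` and `g' = z ^ 2 * a`. -/
def shearDifferential (a z : ℂ) : ℂ →L[ℝ] ℂ :=
  (a • ContinuousLinearMap.id ℝ ℂ) +
    (conjCLE : ℂ →L[ℝ] ℂ).comp ((z ^ 2 * a) • ContinuousLinearMap.id ℝ ℂ)

/-- The inverse of `shearDifferential a z`. -/
def shearDifferentialInv (a z : ℂ) : ℂ →L[ℝ] ℂ :=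
  (a⁻¹ * ((1 - normSq z ^ 2 : ℝ) : ℂ)⁻¹) •
    (ContinuousLinearMap.id ℝ ℂ - ((starRingEnd ℂ) z ^ 2) • (conjCLE : ℂ →L[ℝ] ℂ))

lemma shearDifferential_apply (a z ξ : ℂ) :
    shearDifferential a z ξ = a * ξ + (starRingEnd ℂ) (z ^ 2 * a * ξ) := by
  simp [shearDifferential]

lemma shearDifferentialInv_apply (a z η : ℂ) :
    shearDifferentialInv a z η = (a⁻¹ * ((1 - normSq z ^ 2 : ℝ) : ℂ)⁻¹) *
      (η - (starRingEnd ℂ) z ^ 2 * (starRingEnd ℂ) η) := by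
  simp [shearDifferentialInv]

lemma one_sub_normSq_sq_pos {z : ℂ} (hz : z ∈ disk) : 0 < 1 - normSq z ^ 2 := by
  have := mem_disk_iff.1 hz
  nlinarith [normSq_nonneg z]

/-- `shearDifferential a z` as a continuous linear equivalence. -/
def shearEquiv {a z : ℂ} (ha : a ≠ 0) (hz : z ∈ disk) : ℂ ≃L[ℝ] ℂ :=
  ContinuousLinearEquiv.equivOfInverse (shearDifferential a z) (shearDifferentialInv a z)
    (by
      intro ξ
      have hD : ((1 - normSq z ^ 2 : ℝ) : ℂ) ≠ 0 := ofReal_ne_zero.2 (one_sub_normSq_sq_pos hz).ne'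
      have hD' : ((1 - normSq z ^ 2 : ℝ) : ℂ) = 1 - (z * (starRingEnd ℂ) z) ^ 2 := by
        rw [mul_conj]; push_cast; ring
      -- With `u = aξ` and `η = u + conj(z² u)`, one has `η - z̄² η̄ = (1 - |z|⁴) u`.
      rw [shearDifferentialInv_apply, shearDifferential_apply]
      rw [mul_assoc, inv_mul_eq_iff_eq_mul₀ ha, inv_mul_eq_iff_eq_mul₀ hD, hD']
      simp
      ring)
    (by
      intro η
      have hD : ((1 - normSq z ^ 2 : ℝ) : ℂ) ≠ 0 := ofReal_ne_zero.2 (one_sub_normSq_sq_pos hz).ne'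
      have hD' : ((1 - normSq z ^ 2 : ℝ) : ℂ) = 1 - (z * (starRingEnd ℂ) z) ^ 2 := by
        rw [mul_conj]; push_cast; ring
      rw [shearDifferential_apply, shearDifferentialInv_apply]
      have h1 : a * (a⁻¹ * ((1 - normSq z ^ 2 : ℝ) : ℂ)⁻¹ *
          (η - (starRingEnd ℂ) z ^ 2 * (starRingEnd ℂ) η)) = ((1 - normSq z ^ 2 : ℝ) : ℂ)⁻¹ *
          (η - (starRingEnd ℂ) z ^ 2 * (starRingEnd ℂ) η) := by
        rw [mul_assoc, mul_inv_cancel_left₀ ha]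
      rw [mul_assoc (z ^ 2), h1]
      simp only [map_mul, map_sub, map_pow, map_inv₀, conj_conj, conj_ofReal]
      have h2 : ∀ D p q r : ℂ, D⁻¹ * p + q * (D⁻¹ * r) = D⁻¹ * (p + q * r) := by
        intros; ring
      rw [h2, inv_mul_eq_iff_eq_mul₀ hD, hD']
      ring)

section Inverse

variable {h g a : ℂ → ℂ}

lemma hasFDerivAt_harmonicMap {z : ℂ} (hh : HasDerivAt h (a z) z)
    (hg : HasDerivAt g (z ^ 2 * a z) z) :
    HasFDerivAt (harmonicMap h g) (shearDifferential (a z) z) z := by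
  have h1 := hh.hasFDerivAt.restrictScalars ℝ
  have h2 := (conjCLE : ℂ →L[ℝ] ℂ).hasFDerivAt.comp z (hg.hasFDerivAt.restrictScalars ℝ)
  refine (h1.add h2).congr_fderiv ?_
  ext ξ <;> simp [shearDifferential_apply, mul_comm]

lemma contDiffAt_harmonicMap (hh : ∀ z ∈ disk, HasDerivAt h (a z) z)
    (hg : ∀ z ∈ disk, HasDerivAt g (z ^ 2 * a z) z) {z : ℂ} (hz : z ∈ disk) :
    ContDiffAt ℝ (⊤ : ℕ∞) (harmonicMap h g) z := by
  have hn := Metric.isOpen_ball.mem_nhds hz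
  have hh' : DifferentiableOn ℂ h disk :=
    fun z hz => (hh z hz).differentiableAt.differentiableWithinAt
  have hg' : DifferentiableOn ℂ g disk :=
    fun z hz => (hg z hz).differentiableAt.differentiableWithinAt
  have h1 : ContDiffAt ℝ (⊤ : ℕ∞) h z := (hh'.analyticAt hn).contDiffAt.restrict_scalars ℝ
  have h2 : ContDiffAt ℝ (⊤ : ℕ∞) g z := (hg'.analyticAt hn).contDiffAt.restrict_scalars ℝ
  exact h1.add ((conjCLE : ℂ →L[ℝ] ℂ).contDiff.contDiffAt.comp z h2)

/-- Injectivity forces the global inverse to coincide near `f(z)` with the local one from the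
inverse function theorem, whose smoothness and differential it inherits. -/
lemma inverse_harmonicMap (hh : ∀ z ∈ disk, HasDerivAt h (a z) z)
    (hg : ∀ z ∈ disk, HasDerivAt g (z ^ 2 * a z) z) (ha : ∀ z ∈ disk, a z ≠ 0)
    (hinj : InjOn (harmonicMap h g) disk) {z : ℂ} (hz : z ∈ disk) :
    ContDiffAt ℝ (⊤ : ℕ∞) (Function.invFunOn (harmonicMap h g) disk) (harmonicMap h g z) ∧
    HasFDerivAt (Function.invFunOn (harmonicMap h g) disk) (shearDifferentialInv (a z) z)
      (harmonicMap h g z) := by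
  have hcd := contDiffAt_harmonicMap hh hg hz
  have hfd : HasFDerivAt (harmonicMap h g) (shearEquiv (ha z hz) hz : ℂ →L[ℝ] ℂ) z :=
    hasFDerivAt_harmonicMap (hh z hz) (hg z hz)
  have hn : ((⊤ : ℕ∞) : WithTop ℕ∞) ≠ 0 := by simp
  have hs := hcd.hasStrictFDerivAt' hfd hn
  have hi := hs.to_localInverse
  have himg : hs.localInverse _ _ _ (harmonicMap h g z) = z := hs.localInverse_apply_image
  have hcont : ∀ᶠ w in 𝓝 (harmonicMap h g z), hs.localInverse _ _ _ w ∈ disk := by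
    apply hi.hasFDerivAt.continuousAt.eventually_mem
    rw [himg]
    exact Metric.isOpen_ball.mem_nhds hz
  have heq : Function.invFunOn (harmonicMap h g) disk =ᶠ[𝓝 (harmonicMap h g z)]
      hs.localInverse _ _ _ := by
    filter_upwards [hcont, hs.eventually_right_inverse] with w hw hw'
    have hex : ∃ z ∈ disk, harmonicMap h g z = w := ⟨_, hw, hw'⟩
    exact hinj (Function.invFunOn_mem hex) hw ((Function.invFunOn_eq hex).trans hw'.symm)
  exact ⟨(hcd.to_localInverse hfd hn).congr_of_eventuallyEq heq,
    hi.hasFDerivAt.congr_of_eventuallyEq heq⟩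

end Inverse

/-! ### The gradient of the height function -/

lemma hasFDerivAt_normSq (z : ℂ) :
    HasFDerivAt (fun z : ℂ => normSq z) ((2 * z.re) • reCLM + (2 * z.im) • imCLM) z := by
  have h := (reCLM.hasFDerivAt (x := z)).mul (reCLM.hasFDerivAt (x := z)) |>.add
    ((imCLM.hasFDerivAt (x := z)).mul (imCLM.hasFDerivAt (x := z)))
  refine (h.congr_fderiv ?_).congr_of_eventuallyEq (Eventually.of_forall fun w => ?_)
  · ext <;> simp <;> ring
  · simp [normSq_apply]

/-- The slopes of the minimal graph as functions on the disk, for `l = reCLM` and `l = imCLM`. -/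
def slope (σ : ℝ) (l : ℂ →L[ℝ] ℝ) (z : ℂ) : ℝ := 2 * σ * l z * (1 - normSq z)⁻¹

lemma hasFDerivAt_slope (σ : ℝ) (l : ℂ →L[ℝ] ℝ) {z : ℂ} (hz : z ∈ disk) :
    HasFDerivAt (slope σ l) ((2 * σ * (1 - normSq z)⁻¹) • l +
      (2 * σ * l z * ((1 - normSq z) ^ 2)⁻¹) • ((2 * z.re) • reCLM + (2 * z.im) • imCLM)) z := by
  have h0 : 1 - normSq z ≠ 0 := (sub_pos.2 (mem_disk_iff.1 hz)).ne'
  have h1 := ((hasFDerivAt_normSq z).const_sub 1)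
  have h2 := (hasDerivAt_inv h0).comp_hasFDerivAt z h1
  have h3 := (l.hasFDerivAt (x := z)).const_mul (2 * σ)
  refine (h3.mul h2).congr_fderiv ?_
  ext <;> simp <;> ring

/-- The Gauss map data `z ^ 2` solve the minimal surface equation. -/
lemma minimal_surface_identity {σ : ℝ} (hσ : σ ^ 2 = 1) {z : ℂ} (hz : z ∈ disk) (a : ℂ)
    {A' B' : ℂ →L[ℝ] ℝ}
    (hA : A' = ((2 * σ * (1 - normSq z)⁻¹) • imCLM + (2 * σ * z.im * ((1 - normSq z) ^ 2)⁻¹) •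
      ((2 * z.re) • reCLM + (2 * z.im) • imCLM)).comp (shearDifferentialInv a z))
    (hB : B' = ((2 * σ * (1 - normSq z)⁻¹) • reCLM + (2 * σ * z.re * ((1 - normSq z) ^ 2)⁻¹) •
      ((2 * z.re) • reCLM + (2 * z.im) • imCLM)).comp (shearDifferentialInv a z)) :
    A' 1 * (1 + slope σ reCLM z ^ 2) - 2 * B' 1 * (slope σ imCLM z * slope σ reCLM z) +
      B' I * (1 + slope σ imCLM z ^ 2) = 0 := by
  have h0 : 1 - normSq z ≠ 0 := (sub_pos.2 (mem_disk_iff.1 hz)).ne'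
  subst hA hB
  simp only [ContinuousLinearMap.comp_apply, shearDifferentialInv_apply, slope]
  -- The equation is real-linear in the differentials of the slopes, and it holds for every complex
  -- factor `κ`; the value of `h'` plays no role.
  generalize a⁻¹ * ((1 - normSq z ^ 2 : ℝ) : ℂ)⁻¹ = κ
  simp only [add_apply, smul_apply, reCLM_apply,
    imCLM_apply, smul_eq_mul, mul_re, mul_im, sub_re, sub_im, conj_re, conj_im, sq, one_re, one_im,
    I_re, I_im]
  obtain ⟨D, hD⟩ : ∃ D, D = 1 - normSq z := ⟨_, rfl⟩
  rw [← hD] at h0 ⊢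
  rw [normSq_apply] at hD
  obtain ⟨x, y⟩ := z
  obtain ⟨s, t⟩ := κ
  simp only at hD ⊢
  rw [sq, mul_self_eq_one_iff] at hσ
  rcases hσ with rfl | rfl
  · field_simp
    rw [hD]
    ring
  · field_simp
    rw [hD]
    ring

/-- The differential of the height function. -/
lemma height_differential (σ : ℝ) {a z : ℂ} (ha : a ≠ 0) (hz : z ∈ disk) (η : ℂ) :
    2 * (σ * z * a * shearDifferentialInv a z η).im =
      slope σ imCLM z * η.re + slope σ reCLM z * η.im := by
  have hN := mem_disk_iff.1 hz
  have h0 : 1 - normSq z ≠ 0 := (sub_pos.2 hN).ne'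
  have h1 : 1 + normSq z ≠ 0 := by linarith [normSq_nonneg z]
  -- Here `a` cancels. The imaginary part of the bracket is `(1 + |z|²) Im(zη)`, whose factor `1 +
  -- |z|²` cancels against `1 - |z|⁴`.
  have h2 : σ * z * a * shearDifferentialInv a z η =
      ((σ * (1 - normSq z ^ 2)⁻¹ : ℝ) : ℂ) * (z * η - normSq z * (starRingEnd ℂ) (z * η)) := by
    rw [shearDifferentialInv_apply, ← mul_conj, map_mul]
    push_cast
    field_simp
  have h3 : (1 - normSq z ^ 2)⁻¹ = (1 - normSq z)⁻¹ * (1 + normSq z)⁻¹ := by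
    rw [← mul_inv]; congr 1; ring
  rw [h2, im_ofReal_mul, h3, slope, slope]
  generalize normSq z = N at *
  simp [-map_mul]
  field_simp
  ring

/-! ### Weierstrass–Enneper lifts as minimal graphs. -/

section Lift

variable {h g a : ℂ → ℂ}

/-- The Weierstrass–Enneper lift of a univalent harmonic mapping with dilatation `z ^ 2` is a
minimal graph. -/
lemma liftsToMinimalGraph {σ : ℝ} (hσ : σ ^ 2 = 1) (hh : ∀ z ∈ disk, HasDerivAt h (a z) z)
    (hg : ∀ z ∈ disk, HasDerivAt g (z ^ 2 * a z) z) (ha : ∀ z ∈ disk, a z ≠ 0)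
    (hinj : InjOn (harmonicMap h g) disk) (hopen : IsOpen (harmonicMap h g '' disk))
    {P : ℂ → ℂ} (hP : ∀ z ∈ disk, HasDerivAt P (σ * z * a z) z) {X : ℂ → E3}
    (hX : ∀ z ∈ disk, X z = !₂[(h z + g z).re, (h z - g z).im, 2 * (P z).im]) :
    LiftsToMinimalGraph (harmonicMap h g) X := by
  set Z := Function.invFunOn (harmonicMap h g) disk
  have hZf : ∀ z ∈ disk, Z (harmonicMap h g z) = z := fun z hz =>
    hinj (Function.invFunOn_mem ⟨z, hz, rfl⟩) hz (Function.invFunOn_eq ⟨z, hz, rfl⟩)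
  have hinv := fun z (hz : z ∈ disk) => inverse_harmonicMap hh hg ha hinj hz
  have hP' : DifferentiableOn ℂ P disk :=
    fun z hz => (hP z hz).differentiableAt.differentiableWithinAt
  refine ⟨hopen, fun w => 2 * (P (Z w)).im, ?_, ?_, ?_⟩
  · rintro _ ⟨z, hz, rfl⟩
    have h1 : ContDiffAt ℝ (⊤ : ℕ∞) P (Z (harmonicMap h g z)) := by
      rw [hZf z hz]
      exact (hP'.analyticAt (Metric.isOpen_ball.mem_nhds hz)).contDiffAt.restrict_scalars ℝ
    exact (contDiffAt_const.mul (imCLM.contDiff.contDiffAt.comp _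
      (h1.comp _ (hinv z hz).1))).contDiffWithinAt
  · rintro _ ⟨z, hz, rfl⟩
    have hslope : ∀ l : ℂ →L[ℝ] ℝ, HasFDerivAt (fun w => slope σ l (Z w))
        (((2 * σ * (1 - normSq z)⁻¹) • l + (2 * σ * l z * ((1 - normSq z) ^ 2)⁻¹) •
          ((2 * z.re) • reCLM + (2 * z.im) • imCLM)).comp (shearDifferentialInv (a z) z))
        (harmonicMap h g z) := by
      intro l
      have h1 := hasFDerivAt_slope σ l hz
      rw [← hZf z hz] at h1
      have h2 := h1.comp _ (hinv z hz).2
      rwa [hZf z hz] at h2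
    refine meanCurvature_graphParam_eq_zero hopen (A := fun w => slope σ imCLM (Z w))
      (B := fun w => slope σ reCLM (Z w)) ?_ ⟨z, hz, rfl⟩ (hslope imCLM) (hslope reCLM) ?_
    · rintro _ ⟨z, hz, rfl⟩
      have h1 := (hP z hz).hasFDerivAt.restrictScalars ℝ
      rw [← hZf z hz] at h1
      have h2 := ((imCLM.hasFDerivAt.comp _ (h1.comp _ (hinv z hz).2)).const_mul 2)
      refine h2.congr_fderiv ?_
      simp only [hZf z hz]
      refine ContinuousLinearMap.ext fun η => ?_
      have h3 := height_differential σ (ha z hz) hz η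
      simp only [add_apply, smul_apply, smul_eq_mul, reCLM_apply, imCLM_apply]
      rw [← h3]
      simp [mul_comm]
    · simp only [hZf z hz]
      exact minimal_surface_identity hσ hz (a z) rfl rfl
  · intro z hz
    rw [hX z hz, graphParam, hZf z hz, IsNormalizedShear.harmonicMap_re,
      IsNormalizedShear.harmonicMap_im']

end Lift

section ShearLift

variable {c : ℝ} {h g : ℂ → ℂ}

/-- The two branches of the square root in the Weierstrass–Enneper formula. -/
lemma IsNormalizedShear.exists_sign (hc : c ∈ Icc (-2 : ℝ) 2)
    (H : IsNormalizedShear (slitMap c) sqDilatation h g) {p : ℂ → ℂ}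
    (hp : DifferentiableOn ℂ p disk) (hp2 : ∀ z ∈ disk, p z ^ 2 = deriv g z * deriv h z) :
    ∃ σ : ℝ, σ ^ 2 = 1 ∧ ∀ z ∈ disk, p z = σ * z * (1 / slitDen c z ^ 2) := by
  have hq : DifferentiableOn ℂ (fun z => z * (1 / slitDen c z ^ 2)) disk :=
    differentiableOn_id.mul (differentiableOn_inv_slitDen_sq hc)
  have hmul : ∀ z ∈ disk, (p z - z * (1 / slitDen c z ^ 2)) * (p z + z * (1 / slitDen c z ^ 2)) =
      0 := by
    intro z hz
    have := hp2 z hz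
    rw [(H.hasDerivAt_g hc hz).deriv, (H.hasDerivAt_h hc hz).deriv] at this
    linear_combination this
  -- Analytic functions on a connected set have no zero divisors, so one sign holds throughout the
  -- disk.
  rcases AnalyticOnNhd.eq_zero_or_eq_zero_of_mul_eq_zero
    ((hp.sub hq).analyticOnNhd Metric.isOpen_ball) ((hp.add hq).analyticOnNhd Metric.isOpen_ball)
    hmul isPreconnected_disk with h1 | h1
  · refine ⟨1, by norm_num, fun z hz => ?_⟩
    have := h1 z hz
    simp only [Pi.sub_apply] at this
    push_cast
    linear_combination this
  · refine ⟨-1, by norm_num, fun z hz => ?_⟩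
    have := h1 z hz
    simp only [Pi.add_apply] at this
    push_cast
    linear_combination this

/-- A Weierstrass–Enneper lift in terms of a primitive of the square root. -/
lemma IsNormalizedShear.lift_eq (hc : c ∈ Icc (-2 : ℝ) 2)
    (H : IsNormalizedShear (slitMap c) sqDilatation h g) {X : ℂ → E3}
    (hX : IsWeierstrassEnneperLift h g X) :
    ∃ σ : ℝ, σ ^ 2 = 1 ∧ ∀ P : ℂ → ℂ,
      (∀ z ∈ disk, HasDerivAt P (z * (1 / slitDen c z ^ 2)) z) → P 0 = 0 →
      ∀ z ∈ disk, X z = !₂[(h z + g z).re, (h z - g z).im, 2 * (σ * P z).im] := by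
  obtain ⟨p, hp, hp2, hX⟩ := hX
  obtain ⟨σ, hσ, hσp⟩ := H.exists_sign hc hp hp2
  refine ⟨σ, hσ, fun P hP hP0 z hz => ?_⟩
  rw [hX z hz, integral_radius_eq (P := fun z => σ * P z) hp.continuousOn
    (fun z hz => ((hP z hz).const_mul (σ : ℂ)).congr_deriv (by rw [hσp z hz, mul_assoc])) hz]
  simp only [hP0, mul_zero, sub_zero]

lemma IsNormalizedShear.exists_lift (hc : c ∈ Icc (-2 : ℝ) 2)
    (H : IsNormalizedShear (slitMap c) sqDilatation h g) :
    ∃ X, IsWeierstrassEnneperLift h g X := by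
  refine ⟨_, fun z => z * (1 / slitDen c z ^ 2),
    differentiableOn_id.mul (differentiableOn_inv_slitDen_sq hc), fun z hz => ?_,
    fun z _ => rfl⟩
  rw [(H.hasDerivAt_g hc hz).deriv, (H.hasDerivAt_h hc hz).deriv]
  ring

lemma IsNormalizedShear.liftsToMinimalGraph (hc : c ∈ Icc (-2 : ℝ) 2)
    (H : IsNormalizedShear (slitMap c) sqDilatation h g) {X : ℂ → E3}
    (hX : IsWeierstrassEnneperLift h g X) : LiftsToMinimalGraph (harmonicMap h g) X := by
  obtain ⟨σ, hσ, hXP⟩ := H.lift_eq hc hX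
  have hq : DifferentiableOn ℂ (fun z => z * (1 / slitDen c z ^ 2)) disk :=
    differentiableOn_id.mul (differentiableOn_inv_slitDen_sq hc)
  obtain ⟨P, hP0, hP⟩ := hq.isExactOn_ball.with_val_at 0 0
  exact HarmonicShear.liftsToMinimalGraph hσ (a := fun z => 1 / slitDen c z ^ 2)
    (fun z hz => H.hasDerivAt_h hc hz)
    (fun z hz => (H.hasDerivAt_g hc hz).congr_deriv (by ring))
    (fun z hz => one_div_ne_zero (pow_ne_zero 2 (slitDen_ne_zero hc hz)))
    (H.injOn_and_image hc).1 (H.isCHDDomain hc).isOpen (P := fun z => σ * P z)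
    (fun z hz => ((hP z hz).const_mul (σ : ℂ)).congr_deriv (by ring)) (hXP P hP hP0)

end ShearLift

/-! ### Enneper's surface and the helicoid -/

lemma isometry_of_dist_sq {f : E3 → E3}
    (hf : ∀ x y, (f x 0 - f y 0) ^ 2 + (f x 1 - f y 1) ^ 2 + (f x 2 - f y 2) ^ 2 =
      (x 0 - y 0) ^ 2 + (x 1 - y 1) ^ 2 + (x 2 - y 2) ^ 2) : Isometry f := by
  refine Isometry.of_dist_eq fun x y => ?_
  rw [EuclideanSpace.dist_eq, EuclideanSpace.dist_eq]
  congr 1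
  simp only [Fin.sum_univ_three, Real.dist_eq, sq_abs]
  exact hf x y

/-- The motion carrying the lifts over the slit planes to Enneper's surface. -/
def enneperMotion {δ σ : ℝ} (hδ : δ ^ 2 = 1) (hσ : σ ^ 2 = 1) : E3 ≃ᵢ E3 :=
  IsometryEquiv.mk'
    (fun x => !₂[(√2)⁻¹ * (1 / 3 - δ * x 0 + σ * x 2), (√2)⁻¹ * (1 / 3 - δ * x 0 - σ * x 2),
      -δ * x 1])
    (fun y => !₂[δ * (1 / 3 - (√2)⁻¹ * (y 0 + y 1)), -δ * y 2, σ * ((√2)⁻¹ * (y 0 - y 1))])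
    (by
      intro y
      have hq : (√2)⁻¹ ^ 2 = (1 / 2 : ℝ) := by rw [inv_pow, Real.sq_sqrt zero_le_two]; norm_num
      generalize (√2)⁻¹ = q at *
      ext i
      fin_cases i <;> simp
      · linear_combination q * (q * (y 0 + y 1) - 1 / 3) * hδ + q ^ 2 * (y 0 - y 1) * hσ +
          2 * y 0 * hq
      · linear_combination q * (q * (y 0 + y 1) - 1 / 3) * hδ - q ^ 2 * (y 0 - y 1) * hσ +
          2 * y 1 * hq
      · linear_combination y 2 * hδ)
    (isometry_of_dist_sq (by
      intro x y
      have hq : (√2)⁻¹ ^ 2 = (1 / 2 : ℝ) := by rw [inv_pow, Real.sq_sqrt zero_le_two]; norm_num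
      generalize (√2)⁻¹ = q at *
      simp
      linear_combination 2 * (δ ^ 2 * (x 0 - y 0) ^ 2 + σ ^ 2 * (x 2 - y 2) ^ 2) * hq +
        ((x 0 - y 0) ^ 2 + (x 1 - y 1) ^ 2) * hδ + (x 2 - y 2) ^ 2 * hσ))

lemma enneperMotion_apply {δ σ : ℝ} (hδ : δ ^ 2 = 1) (hσ : σ ^ 2 = 1) (x : E3) :
    enneperMotion hδ hσ x = !₂[(√2)⁻¹ * (1 / 3 - δ * x 0 + σ * x 2),
      (√2)⁻¹ * (1 / 3 - δ * x 0 - σ * x 2), -δ * x 1] := rfl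

/-- The motion carrying the lift over the strip to the helicoid. -/
def helicoidMotion {σ : ℝ} (hσ : σ ^ 2 = 1) : E3 ≃ᵢ E3 :=
  IsometryEquiv.mk' (fun x => !₂[x 1, σ * x 2, x 0]) (fun y => !₂[y 2, y 0, σ * y 1])
    (by
      intro y
      ext i
      fin_cases i <;> simp
      linear_combination y 1 * hσ)
    (isometry_of_dist_sq (by
      intro x y
      simp
      linear_combination (x 2 - y 2) ^ 2 * hσ))

lemma helicoidMotion_apply {σ : ℝ} (hσ : σ ^ 2 = 1) (x : E3) :
    helicoidMotion hσ x = !₂[x 1, σ * x 2, x 0] := rfl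

/-- Enneper's surface at the parameter `exp(iπ/4) ζ`: there `z²` becomes `iζ²`, matching the third
coordinate to `Im ζ²`, while the first two appear rotated by `π/4`. -/
lemma rotated_mem_enneperSurface (ζ : ℂ) :
    (!₂[(√2)⁻¹ * ((ζ + ζ ^ 3 / 3).re - (ζ - ζ ^ 3 / 3).im),
      (√2)⁻¹ * ((ζ + ζ ^ 3 / 3).re + (ζ - ζ ^ 3 / 3).im), (ζ ^ 2).im] : E3) ∈ enneperSurface := by
  have hq : (((√2)⁻¹ : ℝ) : ℂ) ^ 2 = 1 / 2 := by
    rw [← ofReal_pow, inv_pow, Real.sq_sqrt zero_le_two]; norm_num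
  generalize (√2)⁻¹ = q at *
  refine ⟨q * ((1 + I) * ζ), ?_⟩
  have h1 : ((q : ℂ) * ((1 + I) * ζ)) ^ 2 = I * ζ ^ 2 := by
    linear_combination (1 + I) ^ 2 * ζ ^ 2 * hq + ζ ^ 2 / 2 * I_sq
  have h2 : (q : ℂ) * ((1 + I) * ζ) - (q * ((1 + I) * ζ)) ^ 3 / 3 =
      q * ((ζ + ζ ^ 3 / 3) + I * (ζ - ζ ^ 3 / 3)) := by
    rw [pow_succ, h1]
    linear_combination (-q * ζ ^ 3 / 3) * I_sq
  have h3 : (q : ℂ) * ((1 + I) * ζ) + (q * ((1 + I) * ζ)) ^ 3 / 3 =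
      q * ((ζ - ζ ^ 3 / 3) + I * (ζ + ζ ^ 3 / 3)) := by
    rw [pow_succ, h1]
    linear_combination (q * ζ ^ 3 / 3) * I_sq
  simp only [h1, h2, h3, re_ofReal_mul, im_ofReal_mul]
  generalize ζ + ζ ^ 3 / 3 = s
  generalize ζ - ζ ^ 3 / 3 = d
  simp [sub_eq_add_neg, add_comm d.im]

lemma isPartOf_enneperSurface {δ : ℝ} (hδ : δ ^ 2 = 1) {h g : ℂ → ℂ}
    (H : IsNormalizedShear (slitMap (2 * δ)) sqDilatation h g) {X : ℂ → E3}
    (hX : IsWeierstrassEnneperLift h g X) : IsPartOf (X '' disk) enneperSurface := by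
  obtain ⟨σ, hσ, hXP⟩ := H.lift_eq (two_mul_mem_Icc hδ) hX
  -- The constant `1/12` makes the primitive vanish at `z = 0`, where `ζ = 1`.
  have hX' := hXP (fun z => 1 / 12 - (cayley δ z - cayley δ z ^ 3 / 3) / 8) (fun z hz => by
    have hd := hasDerivAt_cayley hδ hz
    refine (((hd.sub ((hd.pow 3).div_const 3)).div_const 8).const_sub (1 / 12)).congr_deriv ?_
    have ha := one_add_mul_ne_zero hδ hz
    have hz1 : z = δ * (1 + δ * z - 1) := by linear_combination (-z) * ofReal_sq_eq_one hδ
    rw [slitDen_two_mul hδ, cayley, show 1 - δ * z = 2 - (1 + δ * z) by ring]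
    clear hd
    generalize 1 + δ * z = a at *
    rw [hz1]
    push_cast
    field_simp
    ring) (by simp [cayley]; norm_num)
  refine ⟨4, enneperMotion hδ hσ, by norm_num, ?_⟩
  rintro _ ⟨z, hz, rfl⟩
  rw [hX' z hz, shear_add_eq_cayley hδ H hz, H.sub_eq z hz, slitMap_eq_cayley hδ hz]
  generalize cayley δ z = ζ
  convert rotated_mem_enneperSurface ζ using 1
  have e1 : (1 / 3 - ζ / 4 - ζ ^ 3 / 12 : ℂ) =
      ((1 / 3 : ℝ) : ℂ) - (ζ + ζ ^ 3 / 3) / (4 : ℝ) := by push_cast; ring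
  have e2 : ((1 - ζ ^ 2) / 4 : ℂ) = (1 - ζ ^ 2) / (4 : ℝ) := by push_cast; ring
  have e3 : (1 / 12 - (ζ - ζ ^ 3 / 3) / 8 : ℂ) =
      ((1 / 12 : ℝ) : ℂ) - (ζ - ζ ^ 3 / 3) / (8 : ℝ) := by push_cast; ring
  rw [e1, e2, e3, re_ofReal_mul, im_ofReal_mul, im_ofReal_mul, sub_re, sub_im, div_ofReal_re,
    div_ofReal_im, div_ofReal_im, ofReal_re, ofReal_im, sub_im, one_im]
  generalize (ζ + ζ ^ 3 / 3).re = A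
  generalize (ζ - ζ ^ 3 / 3).im = B
  generalize (ζ ^ 2).im = D
  generalize hq : (√2)⁻¹ = q
  ext i
  fin_cases i <;> simp [enneperMotion_apply, hq]
  · linear_combination (-4 * q * (1 / 3 - A / 4)) * hδ - q * B * hσ
  · linear_combination (-4 * q * (1 / 3 - A / 4)) * hδ + q * B * hσ
  · linear_combination D * hδ

lemma isPartOf_helicoid {h g : ℂ → ℂ} (H : IsNormalizedShear (slitMap 0) sqDilatation h g)
    {X : ℂ → E3} (hX : IsWeierstrassEnneperLift h g X) : IsPartOf (X '' disk) helicoid := by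
  have hc : (0 : ℝ) ∈ Icc (-2 : ℝ) 2 := by constructor <;> norm_num
  have hβ : Real.pi / 2 ∈ Ioo 0 Real.pi := by constructor <;> linarith [Real.pi_pos]
  obtain ⟨σ, hσ, hXP⟩ := H.lift_eq hc hX
  have hden : ∀ z : ℂ, slitDen 0 z = 1 + z ^ 2 := fun z => by simp [slitDen]
  have hX' := hXP (fun z => z ^ 2 / (1 + z ^ 2) / 2) (fun z hz => by
    have hne := slitDen_ne_zero hc hz
    rw [hden] at hne ⊢
    have h1 := (hasDerivAt_id z).pow 2
    refine ((h1.div (h1.const_add 1) hne).div_const 2).congr_deriv ?_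
    simp
    field_simp
    ring) (by simp)
  refine ⟨4, helicoidMotion hσ, by norm_num, ?_⟩
  rintro _ ⟨z, hz, rfl⟩
  have H' : IsNormalizedShear (slitMap (2 * Real.cos (Real.pi / 2))) sqDilatation h g := by
    simpa using H
  obtain ⟨V, hV⟩ : ∃ V, halfPlaneCoord (Real.pi / 2) z = V := ⟨_, rfl⟩
  have hV0 : V ≠ 0 := hV ▸ halfPlaneCoord_ne_zero _ hz
  have hre := harmonicMap_re_halfPlane hβ H' hz hV
  have him := harmonicMap_im_halfPlane hβ H' hz hV
  rw [Real.sin_pi_div_two, IsNormalizedShear.harmonicMap_re, Real.cos_pi_div_two] at hre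
  rw [Real.sin_pi_div_two, IsNormalizedShear.harmonicMap_im'] at him
  have hu : unimod (Real.pi / 2) = -I := by rw [unimod_eq]; simp
  -- At `β = π/2` all three coordinates become functions of `V`; the height involves `(r - 1/r) cos
  -- x`, to be paired with `(r - 1/r) sin x` from the imaginary part.
  have hP : z ^ 2 / (1 + z ^ 2) / 2 = (1 - I * (V - V⁻¹) / 2) / 4 := by
    have h1 := one_add_unimod_mul_ne_zero (Real.pi / 2) hz
    have h2 := unimod_add_ne_zero (Real.pi / 2) hz
    have h3 := slitDen_ne_zero hc hz
    rw [hden] at h3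
    rw [← hV, halfPlaneCoord, hu] at *
    have h4 : (-I + z) / (1 + -I * z) - ((-I + z) / (1 + -I * z))⁻¹ =
        2 * I * (z ^ 2 - 1) / (1 + z ^ 2) := by
      rw [inv_div, div_sub_div _ _ h1 h2, div_eq_div_iff (mul_ne_zero h1 h2) h3]
      linear_combination (z ^ 2 - 1) * (1 + z ^ 2 - 2 * z * I) * I_sq
    rw [h4]
    field_simp
    linear_combination 2 * (z ^ 2 - 1) * I_sq
  have hPim : (z ^ 2 / (1 + z ^ 2) / 2).im = -((‖V‖ - ‖V‖⁻¹) * Real.cos V.arg / 8) := by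
    have e : ((1 - I * (V - V⁻¹) / 2) / 4 : ℂ) = (1 - I * (V - V⁻¹) / (2 : ℝ)) / (4 : ℝ) := by
      push_cast; ring
    have h1 : V.re = ‖V‖ * Real.cos V.arg := (norm_mul_cos_arg V).symm
    rw [hP, e, div_ofReal_im, sub_im, div_ofReal_im, mul_im, sub_re, inv_re_eq hV0]
    simp
    rw [h1]
    ring
  rw [hX' z hz]
  -- After scaling by `4` the real part is `2 (x + π/2)`, so `t = x + π/2`; this quarter turn
  -- exchanges sine and cosine and accounts for the sign of `s`.
  refine ⟨(-(‖V‖ - ‖V‖⁻¹), V.arg + Real.pi / 2), ?_⟩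
  dsimp only
  rw [im_ofReal_mul, hPim, Real.cos_add_pi_div_two, Real.sin_add_pi_div_two]
  generalize (h z + g z).re = u at *
  generalize (h z - g z).im = v at *
  generalize ‖V‖⁻¹ = r' at *
  generalize ‖V‖ = r at *
  ext i
  fin_cases i <;> simp [helicoidMotion_apply]
  · linear_combination -2 * him
  · linear_combination (r - r') * Real.cos V.arg * hσ
  · linear_combination -2 * hre

end HarmonicShear

end

open HarmonicShear in
theorem theorem5 :
    -- the shear exists and is unique
    (∀ c ∈ Icc (-2 : ℝ) 2, ∃ h g : ℂ → ℂ,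
      IsNormalizedShear (slitMap c) sqDilatation h g ∧
      ∀ h' g' : ℂ → ℂ, IsNormalizedShear (slitMap c) sqDilatation h' g' →
        EqOn h' h disk ∧ EqOn g' g disk) ∧
    ∀ h g : ℝ → ℂ → ℂ,
      (∀ c ∈ Icc (-2 : ℝ) 2, IsNormalizedShear (slitMap c) sqDilatation (h c) (g c)) →
      -- univalence and horizontal convexity
      (∀ c ∈ Icc (-2 : ℝ) 2, MemSH0 (harmonicMap (h c) (g c)) ∧
        IsCHDDomain (harmonicMap (h c) (g c) '' disk)) ∧
      -- continuous deformation from the strip to the slit domains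
      ContinuousOn (fun q : ℝ × ℂ => harmonicMap (h q.1) (g q.1) q.2)
        (Icc (-2 : ℝ) 2 ×ˢ disk) ∧
      (∀ (c : ℕ → ℝ) (c₀ : ℝ), (∀ n, c n ∈ Icc (-2 : ℝ) 2) → Tendsto c atTop (𝓝 c₀) →
        KernelConverges (fun n => harmonicMap (h (c n)) (g (c n)) '' disk) 0
          (harmonicMap (h c₀) (g c₀) '' disk)) ∧
      harmonicMap (h 0) (g 0) '' disk = {w : ℂ | |w.re| < Real.pi / 4} ∧
      harmonicMap (h 2) (g 2) '' disk = {w : ℂ | w.im = 0 ∧ 1 / 3 ≤ w.re}ᶜ ∧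
      harmonicMap (h (-2)) (g (-2)) '' disk = {w : ℂ | w.im = 0 ∧ w.re ≤ -(1 / 3)}ᶜ ∧
      -- lifting to minimal graphs
      (∀ c ∈ Icc (-2 : ℝ) 2, (∃ X, IsWeierstrassEnneperLift (h c) (g c) X) ∧
        ∀ X, IsWeierstrassEnneperLift (h c) (g c) X →
          LiftsToMinimalGraph (harmonicMap (h c) (g c)) X) ∧
      -- identification of the special surfaces
      (∀ X, IsWeierstrassEnneperLift (h (-2)) (g (-2)) X →
        IsPartOf (X '' disk) enneperSurface) ∧
      (∀ X, IsWeierstrassEnneperLift (h 0) (g 0) X → IsPartOf (X '' disk) helicoid) ∧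
      (∀ X, IsWeierstrassEnneperLift (h 2) (g 2) X →
        IsPartOf (X '' disk) enneperSurface) := by
  refine ⟨fun c hc => ?_, fun h g H => ⟨fun c hc =>
    ⟨(H c hc).memSH0 ((H c hc).injOn_and_image hc).1, (H c hc).isCHDDomain hc⟩, continuousOn_harmonicMap H,
    fun c c₀ hc hlim => kernelConverges_harmonicMap H hc hlim, ?_, ?_, ?_,
    fun c hc => ⟨(H c hc).exists_lift hc, fun X hX => (H c hc).liftsToMinimalGraph hc hX⟩,
    fun X hX => ?_, fun X hX => ?_, fun X hX => ?_⟩⟩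
  · obtain ⟨h, g, H⟩ := exists_isNormalizedShear hc
    exact ⟨h, g, H, fun h' g' H' => H.eqOn hc H'⟩
  · exact image_harmonicMap_zero (H 0 (by constructor <;> norm_num))
  · have H2 : IsNormalizedShear (slitMap (2 * 1)) sqDilatation (h 2) (g 2) := by
      rw [mul_one]; exact H 2 (by constructor <;> norm_num)
    rw [image_harmonicMap_slit (by norm_num) H2]
    ext w
    simp
  · have H2 : IsNormalizedShear (slitMap (2 * -1)) sqDilatation (h (-2)) (g (-2)) := by
      rw [mul_neg_one]; exact H (-2) (by constructor <;> norm_num)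
    rw [image_harmonicMap_slit (by norm_num) H2]
    ext w
    simp [neg_lt]
  · refine isPartOf_enneperSurface (δ := -1) (by norm_num) ?_ hX
    rw [mul_neg_one]; exact H (-2) (by constructor <;> norm_num)
  · exact isPartOf_helicoid (H 0 (by constructor <;> norm_num)) hX
  · refine isPartOf_enneperSurface (δ := 1) (by norm_num) ?_ hX
    rw [mul_one]; exact H 2 (by constructor <;> norm_num)
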